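/- Let $\mathcal S=[0,\infty)^2$, $F_1=\{0\}\times(0,\infty)$, $F_2=(0,\infty)\times\{0\}$, $\mathcal S^o=(0,\infty)^2$, let $e^{(1)},e^{(2)}$ be the standard basis of $\mathbb R^2$, and write $i^\#=3-i$ for $i\in\{1,2\}$. For each $n\in\mathbb N=\{1,2,\dots\}$ let $\lambda^n_i,\mu^n_i,\nu^n_i$, $i=1,2$, be positive numbers, let $x^n\in\mathbb Z_+^2$, and let $X^n$ be a continuous-time Markov process on $\mathbb Z_+^2$ with càdlàg paths, with $X^n(0)=x^n$ and with transition intensities $$r^n(x,y)=\begin{cases}\lambda^n_i & \text{if } y=x+e^{(i)},\ i=1,2,\\ \mu^n_i & \text{if } x\in\mathcal S^o,\ y=x-e^{(i)},\ i=1,2,\\ \mu^n_i+\nu^n_i & \text{if } x\in F_{i^\#},\ y=x-e^{(i)},\ i=1,2,\end{cases}$$ all other intensities being zero. The processes $X^n$ are defined on a common probability space. Assume that there are $\lambda_i,\mu_i,\nu_i\in(0,\infty)$ and $\hat\lambda_i,\hat\mu_i,\hat\nu_i\in\mathbb R$ such that, as $n\to\infty$, for $i=1,2$, $$n^{-1/2}(\lambda^n_i-n\lambda_i)\to\hat\lambda_i,\qquad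 n^{-1/2}(\mu^n_i-n\mu_i)\to\hat\mu_i,\qquad n^{-1/2}(\nu^n_i-n\nu_i)\to\hat\nu_i,$$ that $\lambda_i=\mu_i$ for $i=1,2$, that $\nu_1\nu_2>\mu_1\mu_2$, and that $n^{-1/2}x^n\to\hat x$ for some $\hat x\in\mathcal S$. Put $\hat X^n=n^{-1/2}X^n$. Then the sequence $\{\hat X^n,\ n\in\mathbb N\}$ is $C$-tight in $D(\mathbb R_+,\mathbb R_+^2)$: the laws of the processes $\hat X^n$ form a tight sequence of probability measures on the space $D(\mathbb R_+,\mathbb R_+^2)$ of càdlàg paths with the Skorokhod $J_1$ topology, and every weak limit point (limit of a weakly convergent subsequence) of these laws is supported on the set of continuous paths. -/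

import Mathlib

open Set Filter Topology MeasureTheory ProbabilityTheory
open scoped NNReal ENNReal

noncomputable section

/-- A path `f : [0, ∞) → E` is càdlàg: right-continuous with left limits. (At `t = 0` the filter `𝓝[<] t` is
trivial, so that the second condition is void there.) -/
def IsCadlag {E : Type*} [TopologicalSpace E] (f : ℝ≥0 → E) : Prop :=
  ∀ t : ℝ≥0, ContinuousWithinAt f (Ici t) t ∧ ∃ l : E, Tendsto f (𝓝[<] t) (𝓝 l)

theorem IsCadlag.comp {E F : Type*} [TopologicalSpace E] [TopologicalSpace F] {f : ℝ≥0 → E}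
    (hf : IsCadlag f) {g : E → F} (hg : Continuous g) : IsCadlag (fun t => g (f t)) := by
  intro t
  obtain ⟨h, l, hl⟩ := hf t
  exact ⟨hg.continuousAt.comp_continuousWithinAt h, g l, (hg.tendsto l).comp hl⟩

/-- The set `D(ℝ₊, E)` of càdlàg paths. -/
def SkorokhodSpace (E : Type*) [TopologicalSpace E] : Type _ :=
  {f : ℝ≥0 → E // IsCadlag f}

namespace SkorokhodSpace

instance {E : Type*} [TopologicalSpace E] : CoeFun (SkorokhodSpace E) (fun _ => ℝ≥0 → E) :=
  ⟨Subtype.val⟩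

/-- Composition of a path with a continuous map of the state space. -/
def map {E F : Type*} [TopologicalSpace E] [TopologicalSpace F] (g : E → F) (hg : Continuous g)
    (x : SkorokhodSpace E) : SkorokhodSpace F :=
  ⟨fun t => g (x t), x.2.comp hg⟩

/-- The basic neighbourhood of `x` with horizon `T` and radius `ε`: all paths `y` for which some
strictly increasing bijection `lam` of `[0, ∞)` (a time change) satisfies `|lam t - t| < ε` and
`d (y t, x (lam t)) < ε` for all `t ≤ T`. -/
def basicNhd {E : Type*} [PseudoMetricSpace E] (x : SkorokhodSpace E) (T : ℝ≥0) (ε : ℝ) :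
    Set (SkorokhodSpace E) :=
  {y | ∃ lam : ℝ≥0 ≃o ℝ≥0, ∀ t ≤ T, dist (lam t) t < ε ∧ dist (y t) (x (lam t)) < ε}

theorem basicNhd_mono {E : Type*} [PseudoMetricSpace E] (x : SkorokhodSpace E) {T T' : ℝ≥0}
    {ε ε' : ℝ} (hT : T' ≤ T) (hε : ε ≤ ε') : basicNhd x T ε ⊆ basicNhd x T' ε' := by
  rintro y ⟨lam, h⟩
  exact ⟨lam, fun t ht =>
    ⟨(h t (ht.trans hT)).1.trans_le hε, (h t (ht.trans hT)).2.trans_le hε⟩⟩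

/-- The Skorokhod `J₁` topology on `D(ℝ₊, E)`: the sets `basicNhd x T ε` with `ε > 0` form a
neighbourhood base at `x`. Thus `y n → x` iff for every `T` there are time changes `lam n` such
that `lam n t - t → 0` and `d (y n t, x (lam n t)) → 0` uniformly in `t ≤ T`. -/
instance {E : Type*} [PseudoMetricSpace E] : TopologicalSpace (SkorokhodSpace E) where
  IsOpen O := ∀ x ∈ O, ∃ T : ℝ≥0, ∃ ε : ℝ, 0 < ε ∧ basicNhd x T ε ⊆ O
  isOpen_univ := fun _ _ => ⟨0, 1, one_pos, subset_univ _⟩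
  isOpen_inter := by
    rintro O O' hO hO' x ⟨hx, hx'⟩
    obtain ⟨T, ε, hε, h⟩ := hO x hx
    obtain ⟨T', ε', hε', h'⟩ := hO' x hx'
    exact ⟨max T T', min ε ε', lt_min hε hε', subset_inter
      ((basicNhd_mono x (le_max_left _ _) (min_le_left _ _)).trans h)
      ((basicNhd_mono x (le_max_right _ _) (min_le_right _ _)).trans h')⟩
  isOpen_sUnion := by
    rintro C hC x ⟨O, hOC, hx⟩
    obtain ⟨T, ε, hε, h⟩ := hC O hOC x hx
    exact ⟨T, ε, hε, h.trans (subset_sUnion_of_mem hOC)⟩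

instance {E : Type*} [PseudoMetricSpace E] : MeasurableSpace (SkorokhodSpace E) := borel _

instance {E : Type*} [PseudoMetricSpace E] : BorelSpace (SkorokhodSpace E) := ⟨rfl⟩

end SkorokhodSpace

/-- A sequence of probability measures on `D(ℝ₊, E)`, indexed by `n = 1, 2, …`, is `C`-tight: it
is tight for the `J₁` topology, and every weak limit point (the limit of a weakly convergent
subsequence) is supported on the continuous paths. -/
def IsCTight {E : Type*} [PseudoMetricSpace E]
    (P : ℕ+ → ProbabilityMeasure (SkorokhodSpace E)) : Prop :=
  IsTightMeasureSet (range fun n => (P n : Measure (SkorokhodSpace E))) ∧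
  ∀ (φ : ℕ → ℕ+), StrictMono φ → ∀ Q : ProbabilityMeasure (SkorokhodSpace E),
    Tendsto (fun k => P (φ k)) atTop (𝓝 Q) →
    ∀ᵐ x : SkorokhodSpace E ∂(Q : Measure (SkorokhodSpace E)), Continuous (x : ℝ≥0 → E)

/-- A sequence of maps `Y n : Ω → D(ℝ₊, E)` is a `C`-tight sequence of processes: each `Y n` is a
random element of `D(ℝ₊, E)`, and the laws of the `Y n` form a `C`-tight sequence. -/
def IsCTightProcesses {Ω E : Type*} [MeasurableSpace Ω] [PseudoMetricSpace E]
    (μ : ProbabilityMeasure Ω) (Y : ℕ+ → Ω → SkorokhodSpace E) : Prop :=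
  ∃ hY : ∀ n, Measurable (Y n), IsCTight fun n => μ.map (hY n).aemeasurable

/-- `p t x y` is a (standard, honest) transition function on the discrete state space `E` with
transition intensities `r x y`, `x ≠ y`: a semigroup of stochastic matrices such that, as `t ↓ 0`,
`p t x y / t → r x y` for `x ≠ y` and `(1 - p t x x) / t → ∑_{z ≠ x} r x z`. -/
structure IsTransitionFunction {E : Type*} (r : E → E → ℝ) (p : ℝ≥0 → E → E → ℝ) : Prop where
  nonneg : ∀ t x y, 0 ≤ p t x y
  hasSum_one : ∀ t x, HasSum (fun y => p t x y) 1
  zero_self : ∀ x, p 0 x x = 1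
  chapman_kolmogorov : ∀ s t x y, HasSum (fun z => p s x z * p t z y) (p (s + t) x y)
  intensity : ∀ x y, x ≠ y →
    Tendsto (fun t : ℝ≥0 => p t x y / (t : ℝ)) (𝓝[>] 0) (𝓝 (r x y))
  intensity_self : ∀ x,
    Tendsto (fun t : ℝ≥0 => (1 - p t x x) / (t : ℝ)) (𝓝[>] 0) (𝓝 (∑' z : {z // z ≠ x}, r x z))

/-- The `σ`-field generated by the path `X` up to time `s`. -/
abbrev pathHistory {Ω E : Type*} [TopologicalSpace E] [MeasurableSpace E]
    (X : Ω → SkorokhodSpace E) (s : ℝ≥0) : MeasurableSpace Ω :=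
  ⨆ u ∈ Iic s, MeasurableSpace.comap (fun ω => X ω u) inferInstance

/-- `X` is a continuous-time Markov process (with càdlàg paths) on the discrete state space `E`,
started at `x₀`, with transition intensities `r`. -/
structure IsMarkovJumpProcess {Ω E : Type*} [MeasurableSpace Ω] [TopologicalSpace E]
    [MeasurableSpace E] (μ : ProbabilityMeasure Ω) (r : E → E → ℝ) (x₀ : E)
    (X : Ω → SkorokhodSpace E) : Prop where
  measurable : ∀ t : ℝ≥0, Measurable fun ω => X ω t
  initial : ∀ᵐ ω ∂(μ : Measure Ω), X ω 0 = x₀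
  markov : ∃ p : ℝ≥0 → E → E → ℝ, IsTransitionFunction r p ∧
    ∀ (s t : ℝ≥0) (y : E),
      (μ : Measure Ω)[{ω | X ω (s + t) = y}.indicator (fun _ => (1 : ℝ)) | pathHistory X s]
        =ᵐ[(μ : Measure Ω)] fun ω => p t (X ω s) y

/-- The face `F_i` of the lattice quadrant `ℤ₊²`, where `x_i = 0` and the other coordinate is
positive. The other index `3 - i` is `i.rev`, with the indices `1, 2` written as `0, 1 : Fin 2`. -/
def latticeFace (i : Fin 2) : Set (Fin 2 → ℕ) := {x | x i = 0 ∧ 0 < x i.rev}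

/-- The points of `ℤ₊²` in the interior of the quadrant. -/
def latticeInterior : Set (Fin 2 → ℕ) := {x | ∀ i, 0 < x i}

open scoped Classical in
/-- The transition intensities on `ℤ₊²`: from `x` to `x + e_i` at rate `lam i`; from `x` to
`x - e_i` at rate `mu i` if `x` is in the interior, and at rate `mu i + nu i` if `x` is on the face
where the other coordinate vanishes. All other intensities are zero. -/
def quadrantIntensity (lam mu nu : Fin 2 → ℝ) (x y : Fin 2 → ℕ) : ℝ :=
  ∑ i : Fin 2,
    ((if y = x + Pi.single i 1 then lam i else 0)
      + (if x ∈ latticeInterior ∧ x = y + Pi.single i 1 then mu i else 0)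
      + (if x ∈ latticeFace i.rev ∧ x = y + Pi.single i 1 then mu i + nu i else 0))

/-- The closed quadrant `[0, ∞)²` with the Euclidean metric. -/
abbrev Quadrant : Type := {x : EuclideanSpace ℝ (Fin 2) // ∀ i, 0 ≤ x i}

/-- The point `n^{-1/2} x` of the quadrant. -/
def rescale (n : ℕ+) (x : Fin 2 → ℕ) : Quadrant :=
  ⟨WithLp.toLp 2 fun i => (x i : ℝ) / √((n : ℕ) : ℝ), fun i => by
    change 0 ≤ (x i : ℝ) / √((n : ℕ) : ℝ)
    positivity⟩

theorem continuous_rescale (n : ℕ+) : Continuous (rescale n) := continuous_of_discreteTopology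

end

/-! Each coordinate of the walk is its starting value plus a martingale-like noise, a residual drift
of order `√n` (this uses `λ = μ`), and reflection pushes of order `n`: coordinate `i` is pushed up
at rate `μ_i` while it vanishes, and down at rate `ν_i` while it is positive and the other one
vanishes. The pushes are too large to be bounded separately. What saves the argument is
deterministic (`abs_sub_le_of_noise_le`): the pair moves by at most a constant times its noise. If
one coordinate starts high compared with the noise, it stays positive and the other undergoes a
one-dimensional reflection, whose total push is bounded by the noise. If both start low, consider
`ν_2 x_1 + μ_1 x_2`. One face leaves it unchanged and the other does not increase it, because `μ_1
μ_2 ≤ ν_1 ν_2`. At the origin both pushes raise it, but there it is zero. So it stays of the order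
of the noise, and so do both nonnegative coordinates.

The noise is bounded by exponential supermartingales along a time grid (`measure_exp_noise_ge_le`).
Bounded total rates give a second order expansion of the transition operator, whose accumulated
error vanishes as the grid is refined. On a block of length `d²`, a suitable exponent bounds the
noise by a multiple of `√n d (|log d| + 1)` outside an event of probability `O(d⁴)`. There are
`O(d⁻²)` blocks in `[0, T]`, so the rescaled modulus of continuity is small with high probability
(`measure_hasOsc_le`).

Passing to laws (`isCTightProcesses_of_hasOsc`) is an Arzelà–Ascoli argument. The modulus bounds
hold only from some `n` on, depending on the precision, so each single law must be tight as well.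
For this a path is encoded by its jump times and values in a Polish space, and decoding is
continuous. A discontinuity persists on `J₁` neighbourhoods, so the portmanteau theorem excludes it
in the limit. -/

/-! ### Time changes of the half-line -/

/-- A strict contraction `g` vanishing at `0` gives the time change `t ↦ t + g t`. -/
theorem exists_orderIso_add_of_lipschitzWith {K : ℝ≥0} (hK : K < 1) {g : ℝ → ℝ}
    (hg : LipschitzWith K g) (hg0 : g 0 = 0) :
    ∃ lam : ℝ≥0 ≃o ℝ≥0, ∀ t : ℝ≥0, ((lam t : ℝ≥0) : ℝ) = t + g t := by
  have hK' : (K : ℝ) < 1 := by exact_mod_cast hK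
  have key : ∀ s t : ℝ, s ≤ t → (1 - K) * (t - s) ≤ (t + g t) - (s + g s) := by
    intro s t hst
    have h := hg.dist_le_mul t s
    rw [Real.dist_eq, Real.dist_eq, abs_of_nonneg (sub_nonneg.2 hst)] at h
    nlinarith [neg_abs_le (g t - g s)]
  have hnn : ∀ t : ℝ≥0, 0 ≤ (t : ℝ) + g t := by
    intro t
    have h := key 0 t t.2
    rw [hg0] at h
    nlinarith [t.2, mul_nonneg (sub_nonneg.2 hK'.le) t.2]
  let f : ℝ≥0 → ℝ≥0 := fun t => ⟨(t : ℝ) + g t, hnn t⟩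
  have hmono : StrictMono f := by
    intro s t hst
    have hst' : (s : ℝ) < t := by exact_mod_cast hst
    have h := key s t hst'.le
    change (s : ℝ) + g s < t + g t
    nlinarith [mul_pos (sub_pos.2 hK') (sub_pos.2 hst')]
  have hcont : Continuous fun t : ℝ => t + g t := continuous_id.add hg.continuous
  have hsurj : Function.Surjective f := by
    intro u
    -- The slope of `t + g t` is at least `1 - K`, so the value `u` is reached by time `u / (1 -
    -- K)`.
    have hB : (0 : ℝ) ≤ u / (1 - K) := div_nonneg u.2 (sub_nonneg.2 hK'.le)
    have h1 := key 0 (u / (1 - K)) hB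
    rw [hg0, sub_zero, mul_div_cancel₀ _ (sub_pos.2 hK').ne'] at h1
    obtain ⟨t, ht, htu⟩ := intermediate_value_Icc hB hcont.continuousOn
      (show (u : ℝ) ∈ Icc (0 + g 0) (u / (1 - K) + g (u / (1 - K))) from
        ⟨by simp [hg0], by linarith⟩)
    exact ⟨⟨t, ht.1⟩, NNReal.eq htu⟩
  exact ⟨hmono.orderIsoOfSurjective f hsurj, fun t => rfl⟩

/-- Finitely many points with gaps at least `4 η` can be moved by at most `η` by a time change
that moves no point by more than `η`. -/
theorem exists_orderIso_of_close {ι : Type*} (a b : ι → ℝ≥0) {η : ℝ} (hη : 0 ≤ η)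
    (hgap : ∀ i j, a i ≠ a j → 4 * η ≤ dist (a i) (a j))
    (hinj : ∀ i j, a i = a j → b i = b j)
    (hzero : ∃ i, a i = 0 ∧ b i = 0)
    (hclose : ∀ i, dist (a i) (b i) ≤ η) :
    ∃ lam : ℝ≥0 ≃o ℝ≥0, (∀ i, lam (a i) = b i) ∧ ∀ t, dist (lam t) t ≤ η := by
  classical
  -- The prescribed displacements differ by at most `2 η` over gaps of at least `4 η`, hence are
  -- `1/2`-Lipschitz. By `hinj` the choice of index is harmless.
  let d : ℝ → ℝ := fun t => if h : ∃ i, (a i : ℝ) = t then (b h.choose : ℝ) - t else 0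
  have hd : ∀ i, d (a i) = (b i : ℝ) - a i := by
    intro i
    have h : ∃ j, (a j : ℝ) = a i := ⟨i, rfl⟩
    have h2 : b h.choose = b i := hinj _ _ (NNReal.eq h.choose_spec)
    simp only [d, dif_pos h, h2]
  have hdle : ∀ i, |d (a i)| ≤ η := by
    intro i
    have := hclose i
    rw [NNReal.dist_eq, abs_sub_comm] at this
    rwa [hd]
  have hlip : LipschitzOnWith (1 / 2) d (range fun i => (a i : ℝ)) := by
    refine LipschitzOnWith.of_dist_le_mul ?_
    rintro _ ⟨i, rfl⟩ _ ⟨j, rfl⟩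
    by_cases hij : a i = a j
    · simp [hij]
    · have h := hgap i j hij
      rw [NNReal.dist_eq] at h
      rw [Real.dist_eq, Real.dist_eq]
      have h1 := hdle i
      have h2 := hdle j
      rw [abs_le] at h1 h2
      have : |d (a i) - d (a j)| ≤ 2 * η := abs_le.2 ⟨by linarith, by linarith⟩
      push_cast
      linarith
  obtain ⟨g, hg, hgd⟩ := hlip.extend_real
  -- Clamping the extension to `[-η, η]` keeps the Lipschitz constant and the prescribed values.
  let g' : ℝ → ℝ := fun t => max (-η) (min η (g t))
  have hg' : LipschitzWith (1 / 2) g' := (hg.const_min η).const_max (-η)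
  have hg'd : ∀ i, g' (a i) = (b i : ℝ) - a i := by
    intro i
    have h1 := hdle i
    rw [abs_le] at h1
    simp only [g', ← hgd (mem_range_self i)]
    rw [min_eq_right h1.2, max_eq_right h1.1, hd]
  obtain ⟨i₀, ha, hb⟩ := hzero
  have hg0 : g' 0 = 0 := by
    have := hg'd i₀
    rw [ha, hb] at this
    simpa using this
  obtain ⟨lam, hlam⟩ := exists_orderIso_add_of_lipschitzWith (K := 1 / 2)
    (by rw [← NNReal.coe_lt_coe]; push_cast; norm_num) hg' hg0
  refine ⟨lam, fun i => NNReal.eq ?_, fun t => ?_⟩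
  · rw [hlam, hg'd]; ring
  · rw [NNReal.dist_eq, hlam, add_sub_cancel_left, abs_le]
    exact ⟨le_max_left _ _, max_le (by linarith) (min_le_left _ _)⟩

/-! ### The `J₁` uniformity -/

namespace SkorokhodSpace

variable {E : Type*} [PseudoMetricSpace E]

/-- The pairs `(x, y)` with `y` in the basic neighbourhood of `x`. -/
def entourage (E : Type*) [PseudoMetricSpace E] (T : ℝ≥0) (ε : ℝ) :
    Set (SkorokhodSpace E × SkorokhodSpace E) :=
  {p | p.2 ∈ basicNhd p.1 T ε}

theorem entourage_mono {T T' : ℝ≥0} {ε ε' : ℝ} (hT : T' ≤ T) (hε : ε ≤ ε') :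
    entourage E T ε ⊆ entourage E T' ε' := fun p hp => basicNhd_mono p.1 hT hε hp

theorem mem_basicNhd_self (x : SkorokhodSpace E) (T : ℝ≥0) {ε : ℝ} (hε : 0 < ε) :
    x ∈ basicNhd x T ε := ⟨OrderIso.refl _, fun t _ => by simpa using hε⟩

/-- Invert the time change. The horizon shrinks by `ε` so that the inverse keeps `[0, T]` inside
`[0, T']`. -/
theorem mem_basicNhd_symm {x y : SkorokhodSpace E} {T T' : ℝ≥0} {ε : ℝ}
    (hT : (T : ℝ) + ε ≤ T') (h : y ∈ basicNhd x T' ε) : x ∈ basicNhd y T ε := by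
  obtain ⟨lam, hlam⟩ := h
  refine ⟨lam.symm, fun s hs => ?_⟩
  have ht : lam.symm s ≤ T' := by
    by_contra hcon
    have h1 : lam T' < s := by
      have := lam.strictMono (not_le.1 hcon)
      simpa using this
    have h2 := (hlam T' le_rfl).1
    rw [NNReal.dist_eq, abs_lt] at h2
    have h3 : ((lam T' : ℝ≥0) : ℝ) < T := by exact_mod_cast h1.trans_le hs
    linarith
  have := hlam _ ht
  rw [OrderIso.apply_symm_apply] at this
  exact ⟨by rw [dist_comm]; exact this.1, by rw [dist_comm]; exact this.2⟩

/-- Compose the time changes. The larger horizon leaves room for the first of them to move `T` by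
`ε'`. -/
theorem mem_basicNhd_trans {x y z : SkorokhodSpace E} {T T' : ℝ≥0} {ε ε' : ℝ}
    (hT : (T : ℝ) + ε' ≤ T') (h : y ∈ basicNhd x T' ε) (h' : z ∈ basicNhd y T ε') :
    z ∈ basicNhd x T (ε + ε') := by
  obtain ⟨lam, hlam⟩ := h
  obtain ⟨lam', hlam'⟩ := h'
  refine ⟨lam'.trans lam, fun t ht => ?_⟩
  obtain ⟨h1, h2⟩ := hlam' t ht
  have h3 : lam' t ≤ T' := by
    rw [NNReal.dist_eq, abs_lt] at h1
    have : (t : ℝ) ≤ T := by exact_mod_cast ht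
    have : ((lam' t : ℝ≥0) : ℝ) ≤ T' := by linarith
    exact_mod_cast this
  obtain ⟨h4, h5⟩ := hlam _ h3
  rw [OrderIso.trans_apply]
  exact ⟨(dist_triangle _ (lam' t) _).trans_lt (add_lt_add h4 h1),
    (dist_triangle _ (y (lam' t)) _).trans_lt (by linarith)⟩

theorem antitone_entourage_nat :
    Antitone fun n : ℕ => entourage E (n : ℝ≥0) (1 / ((n : ℝ) + 1)) := fun m n hmn =>
  entourage_mono (by exact_mod_cast hmn) (one_div_le_one_div_of_le (by positivity)
    (by exact_mod_cast Nat.succ_le_succ hmn))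

/-- The filter of entourages of the `J₁` uniformity. -/
def unifFilter (E : Type*) [PseudoMetricSpace E] :
    Filter (SkorokhodSpace E × SkorokhodSpace E) :=
  ⨅ n : ℕ, 𝓟 (entourage E (n : ℝ≥0) (1 / ((n : ℝ) + 1)))

theorem mem_unifFilter {s : Set (SkorokhodSpace E × SkorokhodSpace E)} :
    s ∈ unifFilter E ↔ ∃ (T : ℝ≥0) (ε : ℝ), 0 < ε ∧ entourage E T ε ⊆ s := by
  have hb := hasBasis_iInf_principal (directed_of_isDirected_le
    (fun m n h => antitone_entourage_nat (E := E) h))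
  rw [unifFilter, hb.mem_iff]
  constructor
  · rintro ⟨n, -, hn⟩
    exact ⟨n, _, by positivity, hn⟩
  · rintro ⟨T, ε, hε, h⟩
    obtain ⟨n, hn⟩ := exists_nat_ge T
    obtain ⟨m, hm⟩ := exists_nat_one_div_lt hε
    refine ⟨max m n, trivial, (entourage_mono ?_ ?_).trans h⟩
    · exact hn.trans (by exact_mod_cast le_max_right m n)
    · refine le_trans (one_div_le_one_div_of_le (by positivity) ?_) hm.le
      have : (m : ℝ) ≤ (max m n : ℕ) := by exact_mod_cast le_max_left m n
      linarith

/-- The core of the `J₁` uniformity. -/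
def uniformCore (E : Type*) [PseudoMetricSpace E] : UniformSpace.Core (SkorokhodSpace E) where
  uniformity := unifFilter E
  refl := by
    intro s hs
    obtain ⟨T, ε, hε, h⟩ := mem_unifFilter.1 hs
    rintro ⟨x, y⟩ rfl
    exact h (mem_basicNhd_self x T hε)
  symm := by
    intro s hs
    obtain ⟨T, ε, hε, h⟩ := mem_unifFilter.1 hs
    refine mem_unifFilter.2 ⟨T + ε.toNNReal, ε, hε, fun p hp => h ?_⟩
    exact mem_basicNhd_symm (by push_cast; rw [Real.coe_toNNReal _ hε.le]) hp
  comp := by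
    intro s hs
    obtain ⟨T, ε, hε, h⟩ := mem_unifFilter.1 hs
    have h2 : entourage E (T + ε.toNNReal) (ε / 2) ∈ unifFilter E :=
      mem_unifFilter.2 ⟨_, _, half_pos hε, le_rfl⟩
    refine mem_of_superset (mem_lift' h2) ?_
    rintro ⟨x, z⟩ ⟨y, hxy, hyz⟩
    refine h ?_
    have := mem_basicNhd_trans (T := T) (x := x) (y := y) (z := z) (ε := ε / 2) (ε' := ε / 2)
      (by push_cast; rw [Real.coe_toNNReal _ hε.le]; linarith) hxy
      (basicNhd_mono y le_self_add le_rfl hyz)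
    rwa [add_halves] at this

/-- The `J₁` uniformity. -/
instance : UniformSpace (SkorokhodSpace E) :=
  UniformSpace.ofCoreEq (uniformCore E) inferInstance <| by
    ext O
    rw [@isOpen_iff_mem_nhds _ (uniformCore E).toTopologicalSpace O]
    refine forall₂_congr fun x _ => ?_
    rw [UniformSpace.Core.nhds_toTopologicalSpace, mem_comap]
    constructor
    · rintro ⟨T, ε, hε, h⟩
      exact ⟨entourage E T ε, mem_unifFilter.2 ⟨T, ε, hε, le_rfl⟩, fun y hy => h hy⟩
    · rintro ⟨V, hV, h⟩
      obtain ⟨T, ε, hε, h'⟩ := mem_unifFilter.1 hV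
      exact ⟨T, ε, hε, fun y hy => h (h' hy)⟩

theorem uniformity_eq : uniformity (SkorokhodSpace E) = unifFilter E := rfl

/-- The definition of the open sets does not by itself make `basicNhd x T ε` a neighbourhood of `x`;
this comes from the triangle inequality built into the uniformity. -/
theorem mem_nhds_iff_basicNhd {x : SkorokhodSpace E} {s : Set (SkorokhodSpace E)} :
    s ∈ 𝓝 x ↔ ∃ (T : ℝ≥0) (ε : ℝ), 0 < ε ∧ basicNhd x T ε ⊆ s := by
  rw [UniformSpace.mem_nhds_iff]
  constructor
  · rintro ⟨V, hV, h⟩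
    obtain ⟨T, ε, hε, h'⟩ := mem_unifFilter.1 hV
    exact ⟨T, ε, hε, fun y hy => h (h' hy)⟩
  · rintro ⟨T, ε, hε, h⟩
    exact ⟨entourage E T ε, mem_unifFilter.2 ⟨T, ε, hε, le_rfl⟩, fun y hy => h hy⟩

/-- Makes the space pseudometrizable, so that compactness can be checked on sequences. -/
instance : IsCountablyGenerated (uniformity (SkorokhodSpace E)) := by
  rw [uniformity_eq, unifFilter]; infer_instance


theorem tendsto_nhds_iff {ι : Type*} {l : Filter ι} {u : ι → SkorokhodSpace E}
    {x : SkorokhodSpace E} :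
    Tendsto u l (𝓝 x) ↔ ∀ (T : ℝ≥0) (ε : ℝ), 0 < ε → ∀ᶠ i in l, u i ∈ basicNhd x T ε := by
  constructor
  · intro h T ε hε
    exact h (mem_nhds_iff_basicNhd.2 ⟨T, ε, hε, le_rfl⟩)
  · intro h s hs
    obtain ⟨T, ε, hε, h'⟩ := mem_nhds_iff_basicNhd.1 hs
    exact (h T ε hε).mono fun i hi => h' hi

end SkorokhodSpace

/-! ### Moduli of continuity and relative compactness -/

/-- The path `f` oscillates by more than `ε` over some time at most `δ` within `[0, T]`. -/
def HasOsc {E : Type*} [PseudoMetricSpace E] (T : ℝ≥0) (δ ε : ℝ) (f : ℝ≥0 → E) : Prop :=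
  ∃ s ≤ T, ∃ t ≤ T, dist s t ≤ δ ∧ ε < dist (f s) (f t)

theorem HasOsc.mono {E : Type*} [PseudoMetricSpace E] {x : ℝ≥0 → E} {T T' : ℝ≥0} {δ ε : ℝ} (hT : T ≤ T') (h : HasOsc T δ ε x) :
    HasOsc T' δ ε x := by
  obtain ⟨s, hs, t, ht, h⟩ := h
  exact ⟨s, hs.trans hT, t, ht.trans hT, h⟩

namespace SkorokhodSpace

/-- Replace a sequence in the closure by one in `S` whose distance to it, in a compatible
pseudometric, tends to zero. -/
theorem isCompact_closure_of_subseq {X : Type*} [UniformSpace X]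
    [IsCountablyGenerated (uniformity X)] {S : Set X}
    (h : ∀ u : ℕ → X, (∀ n, u n ∈ S) → ∃ x, ∃ φ : ℕ → ℕ, StrictMono φ ∧ Tendsto (u ∘ φ) atTop (𝓝 x)) :
    IsCompact (closure S) := by
  refine IsSeqCompact.isCompact fun u hu => ?_
  let _ := TopologicalSpace.pseudoMetrizableSpacePseudoMetric X
  have h1 : ∀ n : ℕ, ∃ v ∈ S, dist (u n) v < 1 / ((n : ℝ) + 1) := fun n =>
    Metric.mem_closure_iff.1 (hu n) _ (by positivity)
  choose v hvS hv using h1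
  obtain ⟨x, φ, hφ, hx⟩ := h v hvS
  refine ⟨x, mem_closure_of_tendsto hx (Eventually.of_forall fun n => hvS _), φ, hφ, ?_⟩
  refine tendsto_of_tendsto_of_dist hx ?_
  refine squeeze_zero (fun _ => dist_nonneg) (fun n => ?_)
    (tendsto_one_div_add_atTop_nhds_zero_nat.comp hφ.tendsto_atTop)
  rw [dist_comm]
  exact (hv (φ n)).le

section Compactness

variable {E : Type*} [PseudoMetricSpace E]

/-- Chain through `N` equal steps of length at most `δ`. With bounded initial values this bounds the
path at every fixed time. -/
theorem dist_zero_le_of_not_hasOsc {x : ℝ≥0 → E} {T : ℝ≥0} {δ ε : ℝ}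
    (h : ¬ HasOsc T δ ε x) {N : ℕ} (hN : (T : ℝ) ≤ N * δ) (hN0 : 0 < N) :
    dist (x 0) (x T) ≤ N * ε := by
  have hstep : ∀ i : ℕ, i < N →
      dist (x ((i : ℝ≥0) / N * T)) (x (((i + 1 : ℕ) : ℝ≥0) / N * T)) ≤ ε := by
    intro i hi
    by_contra hcon
    have hN1 : (0 : ℝ≥0) < N := by exact_mod_cast hN0
    have hle : ∀ j : ℕ, j ≤ N → (j : ℝ≥0) / N * T ≤ T := fun j hj =>
      mul_le_of_le_one_left zero_le ((div_le_one hN1).2 (by exact_mod_cast hj))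
    refine h ⟨_, hle i hi.le, _, hle (i + 1) hi, ?_, not_le.1 hcon⟩
    have hN1' : (0 : ℝ) < N := by exact_mod_cast hN0
    rw [NNReal.dist_eq]
    push_cast
    rw [← sub_mul, ← sub_div, sub_add_cancel_left, abs_mul, abs_div, abs_neg, abs_one,
      abs_of_pos hN1', abs_of_nonneg T.coe_nonneg, div_mul_eq_mul_div, one_mul, div_le_iff₀ hN1']
    linarith
  have := dist_le_range_sum_of_dist_le (f := fun i : ℕ => x ((i : ℝ≥0) / N * T))
    (d := fun _ => ε) N (fun {i} hi => hstep i hi)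
  have hNN : ((N : ℝ≥0) / N) = 1 := div_self (by exact_mod_cast hN0.ne')
  simpa [hNN] using this

/-- Asymptotically equicontinuous sequences of càdlàg paths with bounded initial values have
subsequences that converge to continuous paths. -/
theorem exists_subseq_tendsto_of_not_hasOsc [ProperSpace E] (u : ℕ → SkorokhodSpace E)
    (c : E) (R : ℝ) (h0 : ∀ m, u m 0 ∈ Metric.closedBall c R)
    (hosc : ∀ k : ℕ, ∃ δ > 0, ∀ᶠ m in atTop, ¬ HasOsc (k : ℝ≥0) δ (1 / ((k : ℝ) + 1)) (u m)) :
    ∃ x, ∃ φ : ℕ → ℕ, StrictMono φ ∧ Tendsto (u ∘ φ) atTop (𝓝 x) := by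
  have hbdd : ∀ t : ℝ≥0, ∃ B : ℝ, ∀ m, u m t ∈ Metric.closedBall c B := by
    intro t
    obtain ⟨k, hk⟩ := exists_nat_ge t
    obtain ⟨δ, hδ, hev⟩ := hosc k
    obtain ⟨M, hM⟩ := eventually_atTop.1 hev
    obtain ⟨N, hN⟩ := exists_nat_ge ((t : ℝ) / δ)
    have hN1 : (t : ℝ) ≤ (N + 1 : ℕ) * δ := by
      rw [div_le_iff₀ hδ] at hN
      push_cast
      nlinarith
    -- The sum takes care of the finitely many `m < M`, for which no modulus is available.
    refine ⟨|R + (N + 1 : ℕ) * (1 / ((k : ℝ) + 1))| + ∑ m ∈ Finset.range M, dist (u m t) c,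
      fun m => ?_⟩
    rw [Metric.mem_closedBall]
    have hsum : 0 ≤ ∑ m ∈ Finset.range M, dist (u m t) c :=
      Finset.sum_nonneg fun _ _ => dist_nonneg
    rcases lt_or_ge m M with hm | hm
    · have : dist (u m t) c ≤ _ := Finset.single_le_sum (f := fun m => dist (u m t) c) (fun _ _ => dist_nonneg)
        (Finset.mem_range.2 hm)
      have h2 := abs_nonneg (R + (N + 1 : ℕ) * (1 / ((k : ℝ) + 1)))
      linarith
    · have h1 := dist_zero_le_of_not_hasOsc (x := u m) (T := t)
        (fun hcon => hM m hm (hcon.mono hk)) hN1 (Nat.succ_pos N)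
      have h2 := Metric.mem_closedBall.1 (h0 m)
      have h3 := dist_triangle (u m t) (u m 0) c
      rw [dist_comm (u m t) (u m 0)] at h3
      have h4 := le_abs_self (R + (N + 1 : ℕ) * (1 / ((k : ℝ) + 1)))
      linarith
  choose B hB using hbdd
  -- A diagonal subsequence converges at every point of a countable dense set of times;
  -- equicontinuity upgrades this to local uniform convergence.
  let d := TopologicalSpace.denseSeq ℝ≥0
  have hcomp : IsCompact (univ.pi fun i : ℕ => Metric.closedBall c (B (d i))) :=
    isCompact_univ_pi fun i => isCompact_closedBall _ _
  obtain ⟨y, -, φ, hφ, hy⟩ := hcomp.tendsto_subseq (x := fun m i => u m (d i))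
    (fun m i _ => hB (d i) m)
  rw [tendsto_pi_nhds] at hy
  set v := u ∘ φ with hv
  have hosc' : ∀ k : ℕ, ∃ δ > 0, ∀ᶠ m in atTop,
      ¬ HasOsc (k : ℝ≥0) δ (1 / ((k : ℝ) + 1)) (v m) := fun k => by
    obtain ⟨δ, hδ, h⟩ := hosc k
    exact ⟨δ, hδ, hφ.tendsto_atTop.eventually h⟩
  have hlarge : ∀ (T : ℝ≥0) (ε : ℝ), 0 < ε → ∃ k : ℕ, T + 1 ≤ k ∧ 1 / ((k : ℝ) + 1) < ε := by
    intro T ε hε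
    obtain ⟨k, hk⟩ := exists_nat_ge (T + 1)
    obtain ⟨m, hm⟩ := exists_nat_one_div_lt hε
    refine ⟨max k m, hk.trans (by exact_mod_cast le_max_left k m), lt_of_le_of_lt ?_ hm⟩
    refine one_div_le_one_div_of_le (by positivity) ?_
    have : (m : ℝ) ≤ (max k m : ℕ) := by exact_mod_cast le_max_right k m
    linarith
  have hcauchy : ∀ (T : ℝ≥0) (ε : ℝ), 0 < ε →
      ∃ M, ∀ m ≥ M, ∀ m' ≥ M, ∀ t ≤ T, dist (v m t) (v m' t) ≤ ε := by
    intro T ε hε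
    obtain ⟨k, hkT, hkε⟩ := hlarge T (ε / 3) (by positivity)
    obtain ⟨δ, hδ, hev⟩ := hosc' k
    -- Radii at most `1` keep the dense times near `[0, T]` below the horizon `k ≥ T + 1`.
    obtain ⟨F, hF⟩ := (isCompact_Icc (a := (0 : ℝ≥0)) (b := T)).elim_finite_subcover
      (fun i : ℕ => Metric.ball (d i) (min δ 1)) (fun i => Metric.isOpen_ball) (by
        intro t _
        obtain ⟨i, hi⟩ := (TopologicalSpace.denseRange_denseSeq ℝ≥0).exists_dist_lt t
          (lt_min hδ one_pos)
        exact mem_iUnion.2 ⟨i, hi⟩)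
    have hF2 : ∀ᶠ m in atTop, ∀ i ∈ F, dist (v m (d i)) (y i) < ε / 6 := by
      rw [Filter.eventually_all_finset]
      intro i _
      exact (Metric.tendsto_nhds.1 (hy i)) _ (by positivity)
    obtain ⟨M, hM⟩ := eventually_atTop.1 (hev.and hF2)
    refine ⟨M, fun m hm m' hm' t ht => ?_⟩
    obtain ⟨i, hiF, hi⟩ := mem_iUnion₂.1 (hF ⟨zero_le, ht⟩)
    rw [Metric.mem_ball, lt_min_iff] at hi
    have htk : t ≤ k := ht.trans (le_self_add.trans hkT)
    have hdk : d i ≤ k := by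
      have h1 := hi.2
      rw [NNReal.dist_eq, abs_lt] at h1
      have h2 : (T : ℝ) + 1 ≤ (k : ℝ≥0) := by exact_mod_cast hkT
      have h3 : (t : ℝ) ≤ T := by exact_mod_cast ht
      have : ((d i : ℝ≥0) : ℝ) ≤ (k : ℝ≥0) := by linarith
      exact_mod_cast this
    have key : ∀ m ≥ M, dist (v m t) (v m (d i)) ≤ ε / 3 := by
      intro m hm
      by_contra hcon
      exact (hM m hm).1 ⟨t, htk, d i, hdk, hi.1.le, hkε.trans (not_le.1 hcon)⟩
    have h1 := key m hm
    have h2 := key m' hm'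
    have h3 := (hM m hm).2 i hiF
    have h4 := (hM m' hm').2 i hiF
    have h5 := dist_triangle4 (v m t) (v m (d i)) (v m' (d i)) (v m' t)
    have h6 := dist_triangle_right (v m (d i)) (v m' (d i)) (y i)
    rw [dist_comm (v m' (d i)) (v m' t)] at h5
    linarith
  have hlim : ∀ t, ∃ a, Tendsto (fun m => v m t) atTop (𝓝 a) := by
    intro t
    refine cauchySeq_tendsto_of_complete (Metric.cauchySeq_iff.2 fun ε hε => ?_)
    obtain ⟨M, hM⟩ := hcauchy t (ε / 2) (half_pos hε)
    exact ⟨M, fun m hm n hn => (hM m hm n hn t le_rfl).trans_lt (half_lt_self hε)⟩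
  choose x hx using hlim
  have hxc : Continuous x := by
    rw [Metric.continuous_iff]
    intro t ε hε
    obtain ⟨k, hkT, hkε⟩ := hlarge t ε hε
    obtain ⟨δ, hδ, hev⟩ := hosc' k
    refine ⟨min δ 1, lt_min hδ one_pos, fun s hs => ?_⟩
    rw [lt_min_iff] at hs
    refine lt_of_le_of_lt ?_ hkε
    refine le_of_tendsto ((hx s).dist (hx t)) (hev.mono fun m hm => ?_)
    by_contra hcon
    have hsk : s ≤ k := by
      have h1 := hs.2
      rw [NNReal.dist_eq, abs_lt] at h1
      have h2 : (t : ℝ) + 1 ≤ (k : ℝ≥0) := by exact_mod_cast hkT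
      have : (s : ℝ) ≤ (k : ℝ≥0) := by linarith
      exact_mod_cast this
    exact hm ⟨s, hsk, t, le_self_add.trans hkT, hs.1.le, not_le.1 hcon⟩
  refine ⟨⟨x, fun t => ⟨hxc.continuousWithinAt, x t, (hxc.tendsto t).mono_left nhdsWithin_le_nhds⟩⟩,
    φ, hφ, tendsto_nhds_iff.2 fun T ε hε => ?_⟩
  obtain ⟨M, hM⟩ := hcauchy T (ε / 2) (half_pos hε)
  -- Locally uniform convergence is `J₁` convergence with the identity as time change.
  refine eventually_atTop.2 ⟨M, fun m hm => ⟨OrderIso.refl _, fun t ht => ⟨by simpa using hε, ?_⟩⟩⟩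
  refine lt_of_le_of_lt ?_ (half_lt_self hε)
  exact le_of_tendsto (tendsto_const_nhds.dist (hx t))
    (eventually_atTop.2 ⟨M, fun m' hm' => hM m hm m' hm' t ht⟩)

/-- A union of relatively compact sets of paths along which the moduli of continuity become small
is relatively compact. -/
theorem isCompact_closure_iUnion [ProperSpace E] (A K : ℕ+ → Set (SkorokhodSpace E))
    (hK : ∀ n, IsCompact (K n)) (hAK : ∀ n, A n ⊆ K n) (c : E) (R : ℝ)
    (h0 : ∀ n, ∀ x ∈ A n, x 0 ∈ Metric.closedBall c R)
    (hosc : ∀ k : ℕ, ∃ δ > 0, ∃ n₀, ∀ n ≥ n₀, ∀ x ∈ A n,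
      ¬ HasOsc (k : ℝ≥0) δ (1 / ((k : ℝ) + 1)) x) :
    IsCompact (closure (⋃ n, A n)) := by
  refine isCompact_closure_of_subseq fun u hu => ?_
  choose ν hν using fun m => mem_iUnion.1 (hu m)
  -- Either infinitely many terms lie in a finite union of the compact sets `K n`, or the indices
  -- tend to infinity and the moduli of continuity apply.
  by_cases hfreq : ∃ N, ∃ᶠ m in atTop, ν m ≤ N
  · obtain ⟨N, hN⟩ := hfreq
    obtain ⟨φ, hφ, hφN⟩ := extraction_of_frequently_atTop hN
    have hcomp : IsCompact (⋃ n ∈ Iic N, K n) := (finite_Iic N).isCompact_biUnion fun n _ => hK n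
    obtain ⟨x, -, ψ, hψ, hx⟩ := hcomp.tendsto_subseq (x := u ∘ φ)
      (fun m => mem_iUnion₂.2 ⟨ν (φ m), hφN m, hAK _ (hν _)⟩)
    exact ⟨x, φ ∘ ψ, hφ.comp hψ, hx⟩
  · push Not at hfreq
    refine exists_subseq_tendsto_of_not_hasOsc u c R (fun m => h0 _ _ (hν m)) fun k => ?_
    obtain ⟨δ, hδ, n₀, hn⟩ := hosc k
    refine ⟨δ, hδ, (hfreq n₀).mono fun m hm => hn _ ?_ _ (hν m)⟩
    exact hm.le

/-- A discontinuous path is in the interior of the sets of paths with a fixed oscillation over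
arbitrarily short times. -/
theorem exists_mem_interior_hasOsc {x : SkorokhodSpace E} (hx : ¬ Continuous (x : ℝ≥0 → E)) :
    ∃ T j : ℕ, ∀ i : ℕ, x ∈ interior
      {y : SkorokhodSpace E | HasOsc (T : ℝ≥0) (1 / ((i : ℝ) + 1)) (1 / ((j : ℝ) + 1)) y} := by
  rw [Metric.continuous_iff] at hx
  push Not at hx
  obtain ⟨t, ε, hε, hs⟩ := hx
  obtain ⟨T, hT⟩ := exists_nat_ge (t + 2)
  obtain ⟨j, hj⟩ := exists_nat_one_div_lt (half_pos hε)
  refine ⟨T, j, fun i => mem_interior_iff_mem_nhds.2 (mem_nhds_iff_basicNhd.2 ?_)⟩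
  set δ : ℝ := 1 / ((i : ℝ) + 1) with hδ
  have hδ0 : 0 < δ := by positivity
  have hδ1 : δ ≤ 1 := by
    rw [hδ, div_le_one (by positivity)]
    have : (0 : ℝ) ≤ i := by positivity
    linarith
  -- Moving both times costs `2 r ≤ δ / 2` on top of their distance `δ / 4`, and an oscillation of
  -- at least `ε - 2 r ≥ ε / 2` survives.
  set r : ℝ := min (δ / 4) (ε / 4) with hr
  have hr0 : 0 < r := by positivity
  have hr1 : r ≤ δ / 4 := min_le_left _ _
  have hr2 : r ≤ ε / 4 := min_le_right _ _
  refine ⟨(T : ℝ≥0) + 1, r, hr0, fun y hy => ?_⟩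
  obtain ⟨lam, hlam⟩ := mem_basicNhd_symm (T := (T : ℝ≥0)) (by push_cast; linarith) hy
  obtain ⟨s, hst, hsx⟩ := hs (δ / 4) (by positivity)
  have hT' : (t : ℝ) + 2 ≤ (T : ℝ≥0) := by exact_mod_cast hT
  have htT : t ≤ T := le_self_add.trans hT
  have hst' := hst
  rw [NNReal.dist_eq, abs_lt] at hst'
  have hsT : s ≤ T := by
    have : (s : ℝ) ≤ (T : ℝ≥0) := by linarith
    exact_mod_cast this
  obtain ⟨a1, a2⟩ := hlam s hsT
  obtain ⟨b1, b2⟩ := hlam t htT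
  have hle : ∀ a : ℝ≥0, dist (lam a) a < r → (a : ℝ) ≤ t + 1 → lam a ≤ T := by
    intro a ha hat
    rw [NNReal.dist_eq, abs_lt] at ha
    have : ((lam a : ℝ≥0) : ℝ) ≤ (T : ℝ≥0) := by linarith
    exact_mod_cast this
  refine ⟨lam s, hle s a1 (by linarith), lam t, hle t b1 (by linarith), ?_, ?_⟩
  · have := dist_triangle4 (lam s) s t (lam t)
    rw [dist_comm t (lam t)] at this
    linarith
  · have := dist_triangle4 (x s) (y (lam s)) (y (lam t)) (x t)
    rw [dist_comm (y (lam t)) (x t)] at this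
    linarith

end Compactness

end SkorokhodSpace

/-! ### From moduli of continuity to `C`-tightness -/

open SkorokhodSpace in
/-- A criterion for `C`-tightness in terms of the modulus of continuity. -/
theorem isCTightProcesses_of_hasOsc {Ω E : Type*} [MeasurableSpace Ω] [PseudoMetricSpace E]
    [ProperSpace E] (μ : ProbabilityMeasure Ω) (Y : ℕ+ → Ω → SkorokhodSpace E)
    (hY : ∀ n, Measurable (Y n))
    (hsingle : ∀ n, IsTightMeasureSet {(μ : Measure Ω).map (Y n)})
    (c : E) (R : ℝ) (h0 : ∀ n, ∀ᵐ ω ∂(μ : Measure Ω), Y n ω 0 ∈ Metric.closedBall c R)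
    (hosc : ∀ (T : ℕ) (ε : ℝ) (η : ℝ≥0∞), 0 < ε → 0 < η → ∃ δ > 0, ∃ n₀, ∀ n ≥ n₀,
      (μ : Measure Ω) {ω | HasOsc (T : ℝ≥0) δ ε (Y n ω)} ≤ η) :
    IsCTightProcesses μ Y := by
  refine ⟨hY, ?_, ?_⟩
  · rw [isTightMeasureSet_iff_exists_isCompact_measure_compl_le]
    intro ε hε
    obtain ⟨η, hη, hηsum⟩ := ENNReal.exists_pos_sum_of_countable' (ENNReal.half_pos hε.ne').ne' ℕ
    have hK : ∀ n, ∃ K : Set (SkorokhodSpace E), IsCompact K ∧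
        (μ : Measure Ω).map (Y n) Kᶜ ≤ ε / 2 := fun n => by
      obtain ⟨K, hK, h⟩ := isTightMeasureSet_iff_exists_isCompact_measure_compl_le.1 (hsingle n)
        (ε / 2) (ENNReal.half_pos hε.ne')
      exact ⟨K, hK, h _ rfl⟩
    choose K hK hKm using hK
    choose δ hδ N hN using fun k : ℕ => hosc k (1 / ((k : ℝ) + 1)) (η k) (by positivity) (hη k)
    -- The `k`-th modulus condition is imposed only on indices from `N k` on, where it fails with
    -- probability at most `η k`; the compact set `K n` covers the remaining conditions.
    let A : ℕ+ → Set (SkorokhodSpace E) := fun n => {x | x ∈ K n ∧ x 0 ∈ Metric.closedBall c R ∧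
      ∀ k, N k ≤ n → ¬ HasOsc (k : ℝ≥0) (δ k) (1 / ((k : ℝ) + 1)) x}
    refine ⟨closure (⋃ n, A n), isCompact_closure_iUnion A K hK (fun n x hx => hx.1) c R
      (fun n x hx => hx.2.1) (fun k => ⟨δ k, hδ k, N k, fun n hn x hx => hx.2.2 k hn⟩), ?_⟩
    rintro _ ⟨n, rfl⟩
    simp only [ProbabilityMeasure.toMeasure_map]
    rw [Measure.map_apply (hY n) isClosed_closure.measurableSet.compl]
    have hsub : Y n ⁻¹' (closure (⋃ n, A n))ᶜ ⊆ (Y n ⁻¹' (K n)ᶜ ∪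
        {ω | ¬ Y n ω 0 ∈ Metric.closedBall c R}) ∪
        ⋃ k, {ω | N k ≤ n ∧ HasOsc (k : ℝ≥0) (δ k) (1 / ((k : ℝ) + 1)) (Y n ω)} := by
      intro ω hω
      by_contra hcon
      simp only [mem_union, mem_preimage, mem_compl_iff, mem_ofPred_eq, mem_iUnion, not_or,
        not_not, not_exists, not_and] at hcon
      exact hω (subset_closure (mem_iUnion.2 ⟨n, hcon.1.1, hcon.1.2, hcon.2⟩))
    refine (measure_mono hsub).trans ((measure_union_le _ _).trans ?_)
    have h1 : (μ : Measure Ω) (Y n ⁻¹' (K n)ᶜ ∪ {ω | ¬ Y n ω 0 ∈ Metric.closedBall c R}) ≤ ε / 2 := by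
      refine (measure_union_le _ _).trans ?_
      rw [show (μ : Measure Ω) {ω | ¬ Y n ω 0 ∈ Metric.closedBall c R} = 0 from h0 n, add_zero]
      exact (Measure.le_map_apply (hY n).aemeasurable _).trans (hKm n)
    have h2 : (μ : Measure Ω) (⋃ k, {ω | N k ≤ n ∧
        HasOsc (k : ℝ≥0) (δ k) (1 / ((k : ℝ) + 1)) (Y n ω)}) ≤ ε / 2 := by
      refine (measure_iUnion_le _).trans (le_trans (ENNReal.tsum_le_tsum fun k => ?_) hηsum.le)
      by_cases hk : N k ≤ n
      · simpa [hk] using hN k n hk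
      · simp [hk]
    calc _ ≤ ε / 2 + ε / 2 := add_le_add h1 h2
      _ = ε := ENNReal.add_halves ε
  · intro φ hφ Q hQ
    -- Interiors are taken because the portmanteau inequality needed here is the one for open sets.
    let U : ℕ → ℕ → ℕ → Set (SkorokhodSpace E) := fun T j i => interior
      {y : SkorokhodSpace E | HasOsc (T : ℝ≥0) (1 / ((i : ℝ) + 1)) (1 / ((j : ℝ) + 1)) y}
    have hsub : {x : SkorokhodSpace E | ¬ Continuous (x : ℝ≥0 → E)} ⊆ ⋃ T, ⋃ j, ⋂ i, U T j i := by
      intro x hx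
      obtain ⟨T, j, h⟩ := exists_mem_interior_hasOsc hx
      exact mem_iUnion₂.2 ⟨T, j, mem_iInter.2 h⟩
    refine measure_mono_null hsub (measure_iUnion_null fun T => measure_iUnion_null fun j => ?_)
    refine le_antisymm (ENNReal.le_of_forall_pos_le_add fun η hη _ => ?_) zero_le
    rw [zero_add]
    obtain ⟨δ, hδ, n₀, hn₀⟩ := hosc T (1 / ((j : ℝ) + 1)) η (by positivity) (by exact_mod_cast hη)
    obtain ⟨i, hi⟩ := exists_nat_one_div_lt hδ
    refine (measure_mono (iInter_subset _ i)).trans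
      ((ProbabilityMeasure.le_liminf_measure_open_of_tendsto hQ isOpen_interior).trans ?_)
    refine (liminf_le_limsup).trans (limsup_le_of_le (h := ?_))
    have hev : ∀ᶠ k in atTop, n₀ ≤ φ k := hφ.tendsto_atTop.eventually_ge_atTop n₀
    refine hev.mono fun k hk => ?_
    simp only [ProbabilityMeasure.toMeasure_map]
    rw [Measure.map_apply (hY _) isOpen_interior.measurableSet]
    refine (measure_mono fun ω hω => ?_).trans (hn₀ _ hk)
    obtain ⟨s, hs, t, ht, h1, h2⟩ := interior_subset hω
    exact ⟨s, hs, t, ht, h1.trans hi.le, h2⟩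

/-! ### Step paths as functions of their values and jump times -/

/-- Strictly increasing sequences of times from `0` to `∞`. -/
def divergentTimes : Set (ℕ → ℝ≥0) :=
  {T | T 0 = 0 ∧ (∀ i, T i < T (i + 1)) ∧ ∀ j : ℕ, ∃ i, (j : ℝ≥0) < T i}

theorem divergentTimes.strictMono {T : ℕ → ℝ≥0} (hT : T ∈ divergentTimes) : StrictMono T :=
  strictMono_nat_of_lt_succ hT.2.1

theorem measurableSet_divergentTimes : MeasurableSet divergentTimes := by
  have h1 : MeasurableSet {T : ℕ → ℝ≥0 | T 0 = 0} :=
    measurableSet_eq_fun (measurable_pi_apply 0) measurable_const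
  have h2 : MeasurableSet {T : ℕ → ℝ≥0 | ∀ i, T i < T (i + 1)} := by
    rw [ofPred_forall]
    exact MeasurableSet.iInter fun i =>
      measurableSet_lt (measurable_pi_apply i) (measurable_pi_apply (i + 1))
  have h3 : MeasurableSet {T : ℕ → ℝ≥0 | ∀ j : ℕ, ∃ i, (j : ℝ≥0) < T i} := by
    rw [ofPred_forall]
    refine MeasurableSet.iInter fun j => ?_
    rw [ofPred_exists]
    exact MeasurableSet.iUnion fun i => measurableSet_lt measurable_const (measurable_pi_apply i)
  exact h1.inter (h2.inter h3)

/-- The index of the interval `[T i, T (i + 1))` that contains `t`. -/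
noncomputable def stepIndex (T : ℕ → ℝ≥0) (t : ℝ≥0) : ℕ := sInf {i | t < T (i + 1)}

theorem stepIndex_eq {T : ℕ → ℝ≥0} (hT : T ∈ divergentTimes) {t : ℝ≥0} {i : ℕ} (h1 : T i ≤ t)
    (h2 : t < T (i + 1)) : stepIndex T t = i := by
  refine le_antisymm (Nat.sInf_le h2) (le_csInf ⟨i, h2⟩ fun j hj => ?_)
  by_contra hlt
  exact absurd (lt_of_lt_of_le hj ((divergentTimes.strictMono hT).monotone (not_le.1 hlt)))
    (not_lt.2 h1)

theorem exists_mem_step {T : ℕ → ℝ≥0} (hT : T ∈ divergentTimes) (t : ℝ≥0) :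
    ∃ i, T i ≤ t ∧ t < T (i + 1) := by
  have hne : ∃ i, t < T (i + 1) := by
    obtain ⟨j, hj⟩ := exists_nat_ge t
    obtain ⟨i, hi⟩ := hT.2.2 j
    exact ⟨i, hj.trans_lt (hi.trans (hT.2.1 i))⟩
  classical
  refine ⟨Nat.find hne, ?_, Nat.find_spec hne⟩
  rcases h : Nat.find hne with _ | k
  · rw [hT.1]; exact zero_le
  · exact not_lt.1 (Nat.find_min hne (m := k) (by omega))

theorem isCadlag_step {E : Type*} [TopologicalSpace E] {T : ℕ → ℝ≥0} (hT : T ∈ divergentTimes)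
    (a : ℕ → E) : IsCadlag fun t => a (stepIndex T t) := by
  intro t
  obtain ⟨i, h1, h2⟩ := exists_mem_step hT t
  constructor
  · have hev : ∀ᶠ s in 𝓝[≥] t, a (stepIndex T s) = a (stepIndex T t) := by
      filter_upwards [Ico_mem_nhdsGE h2] with s hs
      rw [stepIndex_eq hT h1 h2, stepIndex_eq hT (h1.trans hs.1) hs.2]
    exact (tendsto_const_nhds).congr' (hev.mono fun s hs => hs.symm)
  · by_cases ht : t = 0
    · subst ht
      refine ⟨a 0, ?_⟩
      have : (𝓝[<] (0 : ℝ≥0)) = ⊥ := by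
        have : Iio (0 : ℝ≥0) = ∅ := by ext; simp
        rw [this, nhdsWithin_empty]
      rw [this]; exact tendsto_bot
    · have key : ∃ j, T j < t ∧ t ≤ T (j + 1) := by
        rcases h1.lt_or_eq with h | h
        · exact ⟨i, h, h2.le⟩
        · rcases i with _ | j
          · exact absurd (h.symm.trans hT.1) ht
          · exact ⟨j, h ▸ hT.2.1 j, h.ge⟩
      obtain ⟨j, hj1, hj2⟩ := key
      refine ⟨a j, (tendsto_const_nhds (x := a j)).congr' ?_⟩
      filter_upwards [Ioo_mem_nhdsLT hj1] with s hs
      rw [stepIndex_eq hT hs.1.le (hs.2.trans_le hj2)]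

theorem isCadlag_const {E : Type*} [TopologicalSpace E] (c : E) : IsCadlag fun _ : ℝ≥0 => c :=
  fun _ => ⟨continuousWithinAt_const, c, tendsto_const_nhds⟩

open scoped Classical in
/-- The step path with values `g (p.1 i)` on `[p.2 i, p.2 (i + 1))`. -/
noncomputable def stepPath {S E : Type*} [TopologicalSpace E] (g : S → E)
    (p : (ℕ → S) × (ℕ → ℝ≥0)) : SkorokhodSpace E :=
  ⟨fun t => if p.2 ∈ divergentTimes then g (p.1 (stepIndex p.2 t)) else g (p.1 0), by
    split_ifs with h
    · exact isCadlag_step h fun i => g (p.1 i)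
    · exact isCadlag_const (g (p.1 0))⟩

open scoped Classical in
theorem stepPath_apply {S E : Type*} [TopologicalSpace E] (g : S → E)
    {p : (ℕ → S) × (ℕ → ℝ≥0)} (hp : p.2 ∈ divergentTimes) {t : ℝ≥0} {i : ℕ} (h1 : p.2 i ≤ t)
    (h2 : t < p.2 (i + 1)) : stepPath g p t = g (p.1 i) := by
  change (if p.2 ∈ divergentTimes then g (p.1 (stepIndex p.2 t)) else g (p.1 0)) = _
  rw [if_pos hp, stepIndex_eq hp h1 h2]

/-- Since `S` is discrete, nearby encodings have equal values on the first `N` intervals and nearby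
times. A time change matching these times makes the paths agree exactly up to the horizon. -/
theorem continuousOn_stepPath {S E : Type*} [TopologicalSpace S] [DiscreteTopology S]
    [PseudoMetricSpace E] (g : S → E) :
    ContinuousOn (stepPath g) {p | p.2 ∈ divergentTimes} := by
  intro p hp
  refine SkorokhodSpace.tendsto_nhds_iff.2 fun H ε hε => ?_
  obtain ⟨N, hN⟩ : ∃ N, H + 1 < p.2 N := by
    obtain ⟨j, hj⟩ := exists_nat_ge (H + 1)
    obtain ⟨i, hi⟩ := hp.2.2 j
    exact ⟨i, hj.trans_lt hi⟩
  have hmono := divergentTimes.strictMono hp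
  -- Gaps `6 η` for `p` leave gaps `4 η` for `q`, as the interpolation of times requires; `η < 1`
  -- keeps the `N`-th time of `q` beyond the horizon.
  obtain ⟨η, hηgap, hη0, hηε⟩ : ∃ η : ℝ, (∀ i ∈ Finset.range N, 6 * η ≤ (p.2 (i + 1) : ℝ) - p.2 i) ∧
      0 < η ∧ η < min ε 1 := by
    have h1 : ∀ᶠ η : ℝ in 𝓝[>] 0, ∀ i ∈ Finset.range N, 6 * η ≤ (p.2 (i + 1) : ℝ) - p.2 i := by
      rw [Filter.eventually_all_finset]
      intro i _
      have hi : (0 : ℝ) < ((p.2 (i + 1) : ℝ) - p.2 i) / 6 := by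
        have : (p.2 i : ℝ) < p.2 (i + 1) := by exact_mod_cast hp.2.1 i
        linarith
      filter_upwards [Ioo_mem_nhdsGT hi] with η hη
      linarith [hη.2]
    have h2 : ∀ᶠ η : ℝ in 𝓝[>] 0, η ∈ Ioo 0 (min ε 1) := Ioo_mem_nhdsGT (lt_min hε one_pos)
    obtain ⟨η, h, h'⟩ := (h1.and h2).exists
    exact ⟨η, h, h'.1, h'.2⟩
  rw [lt_min_iff] at hηε
  have hv : ∀ᶠ q in 𝓝[{p | p.2 ∈ divergentTimes}] p, ∀ i ∈ Finset.range N, q.1 i = p.1 i := by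
    rw [Filter.eventually_all_finset]
    intro i _
    have hc : Continuous fun q : (ℕ → S) × (ℕ → ℝ≥0) => q.1 i :=
      (continuous_apply i).comp continuous_fst
    have := (hc.tendsto p).mono_left
      (nhdsWithin_le_nhds (s := {p : (ℕ → S) × (ℕ → ℝ≥0) | p.2 ∈ divergentTimes}))
    rw [nhds_discrete] at this
    exact tendsto_pure.1 this
  have hs : ∀ᶠ q in 𝓝[{p | p.2 ∈ divergentTimes}] p,
      ∀ i ∈ Finset.range (N + 1), dist (q.2 i) (p.2 i) ≤ η := by
    rw [Filter.eventually_all_finset]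
    intro i _
    have hc : Continuous fun q : (ℕ → S) × (ℕ → ℝ≥0) => q.2 i :=
      (continuous_apply i).comp continuous_snd
    have := (hc.tendsto p).mono_left
      (nhdsWithin_le_nhds (s := {p : (ℕ → S) × (ℕ → ℝ≥0) | p.2 ∈ divergentTimes}))
    exact (Metric.tendsto_nhds.1 this η hη0).mono fun q hq => hq.le
  filter_upwards [hv, hs, self_mem_nhdsWithin] with q hqv hqs hq
  have hqmono := divergentTimes.strictMono hq
  have hgap : ∀ i j : Fin (N + 1), i < j → 4 * η ≤ (q.2 j : ℝ) - q.2 i := by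
    intro i j hij
    have hij' : (i : ℕ) < j := hij
    have h1 := hηgap i (Finset.mem_range.2 (by omega))
    have h2 : (p.2 (i + 1) : ℝ) ≤ p.2 j := by exact_mod_cast hmono.monotone hij'
    have h3 := hqs i (Finset.mem_range.2 i.2)
    have h4 := hqs j (Finset.mem_range.2 j.2)
    rw [NNReal.dist_eq, abs_le] at h3 h4
    linarith
  obtain ⟨lam, hlam, hlamd⟩ := exists_orderIso_of_close (ι := Fin (N + 1)) (fun i => q.2 i)
    (fun i => p.2 i) hη0.le (by
      intro i j hij
      rcases lt_trichotomy i j with h | h | h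
      · rw [dist_comm, NNReal.dist_eq]
        exact (hgap i j h).trans (le_abs_self _)
      · exact absurd (h ▸ rfl) hij
      · rw [NNReal.dist_eq]
        exact (hgap j i h).trans (le_abs_self _))
    (fun i j hij => by rw [hqmono.injective hij])
    ⟨0, by simpa using hq.1, by simpa using hp.1⟩
    (fun i => hqs i (Finset.mem_range.2 i.2))
  refine ⟨lam, fun t ht => ⟨(hlamd t).trans_lt hηε.1, ?_⟩⟩
  obtain ⟨i, h1, h2⟩ := exists_mem_step hq t
  have hiN : i < N := by
    by_contra hcon
    have h3 : q.2 N ≤ t := (hqmono.monotone (not_lt.1 hcon)).trans h1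
    have h4 := hqs N (Finset.mem_range.2 (Nat.lt_succ_self N))
    rw [NNReal.dist_eq, abs_le] at h4
    have h5 : (q.2 N : ℝ) ≤ H := by exact_mod_cast h3.trans ht
    have h6 : (H : ℝ) + 1 < p.2 N := by exact_mod_cast hN
    linarith [hηε.2]
  have hl : ∀ j, j ≤ N → lam (q.2 j) = p.2 j := fun j hj => hlam ⟨j, by omega⟩
  rw [stepPath_apply g hq h1 h2, stepPath_apply g hp (t := lam t) (i := i)
    (by rw [← hl i hiN.le]; exact lam.monotone h1)
    (by rw [← hl (i + 1) hiN]; exact lam.strictMono h2),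
    hqv i (Finset.mem_range.2 hiN), dist_self]
  exact hε

/-! ### Jump times of càdlàg paths in a discrete space -/

section JumpTimes

variable {S : Type*}

theorem IsCadlag.exists_const_right [TopologicalSpace S] [DiscreteTopology S] {x : ℝ≥0 → S} (hx : IsCadlag x) (t : ℝ≥0) :
    ∃ r > 0, ∀ u < r, x (t + u) = x t := by
  have h := (hx t).1
  rw [ContinuousWithinAt, nhds_discrete, tendsto_pure] at h
  obtain ⟨u, hu, h'⟩ := mem_nhdsGE_iff_exists_Ico_subset.1 h
  refine ⟨u - t, tsub_pos_of_lt hu, fun v hv => h' ⟨le_self_add, ?_⟩⟩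
  rw [add_comm]
  exact lt_tsub_iff_right.1 hv

open scoped Classical in
/-- The time from `t` to the next jump of `x`, capped at `1`. -/
noncomputable def jumpGap (x : ℝ≥0 → S) (t : ℝ≥0) : ℝ≥0 :=
  -- Rational offsets make this a countable infimum, hence measurable in the path; the cap keeps it
  -- finite when no jump follows.
  ⨅ q : ℚ≥0, if x (t + (q : ℝ≥0)) = x t then 1 else min (q : ℝ≥0) 1

theorem min_le_jumpGap {x : ℝ≥0 → S} {t r : ℝ≥0} (h : ∀ u < r, x (t + u) = x t) :
    min r 1 ≤ jumpGap x t := by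
  refine le_ciInf fun q => ?_
  split_ifs with hq
  · exact min_le_right _ _
  · exact min_le_min (not_lt.1 fun hlt => hq (h _ hlt)) le_rfl

variable [TopologicalSpace S] [DiscreteTopology S]

theorem jumpGap_pos {x : ℝ≥0 → S} (hx : IsCadlag x) (t : ℝ≥0) : 0 < jumpGap x t := by
  obtain ⟨r, hr, h⟩ := hx.exists_const_right t
  exact (lt_min hr one_pos).trans_le (min_le_jumpGap h)

/-- By right-continuity, a change of value seen at offset `u` is still seen at slightly larger
rational offsets. -/
theorem eq_of_lt_jumpGap {x : ℝ≥0 → S} (hx : IsCadlag x) {t u : ℝ≥0} (hu : u < jumpGap x t) :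
    x (t + u) = x t := by
  by_contra hne
  obtain ⟨r, hr, h⟩ := hx.exists_const_right (t + u)
  obtain ⟨q, hq1, hq2⟩ : ∃ q : ℚ≥0, u < (q : ℝ≥0) ∧ (q : ℝ≥0) < min (jumpGap x t) (u + r) := by
    obtain ⟨q, hq1, hq2⟩ := exists_rat_btwn 
      (show (u : ℝ) < (min (jumpGap x t) (u + r) : ℝ≥0) by
        exact_mod_cast lt_min hu (lt_add_of_pos_right u hr))
    have hq0 : 0 ≤ q := by
      have : (0 : ℝ) < q := u.coe_nonneg.trans_lt hq1
      exact_mod_cast this.le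
    refine ⟨⟨q, hq0⟩, ?_, ?_⟩
    · rw [← NNReal.coe_lt_coe]; exact hq1
    · rw [← NNReal.coe_lt_coe]; exact hq2
  rw [lt_min_iff] at hq2
  have h1 : x (t + (q : ℝ≥0)) ≠ x t := by
    have := h ((q : ℝ≥0) - u) (by rw [tsub_lt_iff_left hq1.le]; exact hq2.2)
    rw [add_assoc, add_tsub_cancel_of_le hq1.le] at this
    rw [this]; exact hne
  have h2 : jumpGap x t ≤ (q : ℝ≥0) := by
    refine (ciInf_le (OrderBot.bddBelow _) q).trans ?_
    rw [if_neg h1]; exact min_le_left _ _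
  exact absurd hq2.1 (not_lt.2 h2)

/-- The successive jump times of `x`, with additional times that make all gaps at most `1`. -/
noncomputable def jumpTimes (x : ℝ≥0 → S) : ℕ → ℝ≥0
  | 0 => 0
  | k + 1 => jumpTimes x k + jumpGap x (jumpTimes x k)

/-- If the times accumulated at `L`, the left limit there would make the path constant just before
`L`. The next time would then reach `L` or lie a full unit later, and either is impossible for all
late indices. -/
theorem jumpTimes_mem {x : ℝ≥0 → S} (hx : IsCadlag x) : jumpTimes x ∈ divergentTimes := by
  have hlt : ∀ i, jumpTimes x i < jumpTimes x (i + 1) := fun i =>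
    lt_add_of_pos_right _ (jumpGap_pos hx _)
  refine ⟨rfl, hlt, ?_⟩
  by_contra hcon
  push Not at hcon
  obtain ⟨j, hj⟩ := hcon
  have hmono : StrictMono (jumpTimes x) := strictMono_nat_of_lt_succ hlt
  have hbdd : BddAbove (range (jumpTimes x)) := ⟨j, by rintro _ ⟨i, rfl⟩; exact hj i⟩
  have hlim := tendsto_atTop_ciSup hmono.monotone hbdd
  set L := ⨆ i, jumpTimes x i with hL
  have hltL : ∀ i, jumpTimes x i < L := fun i => (hlt i).trans_le (le_ciSup hbdd _)
  obtain ⟨-, l, hl⟩ := hx L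
  rw [nhds_discrete, tendsto_pure] at hl
  obtain ⟨a, ha, hal⟩ := (mem_nhdsLT_iff_exists_Ioo_subset' (hltL 0)).1 hl
  obtain ⟨k, hk⟩ := (hlim.eventually (lt_mem_nhds ha)).exists
  have hconst : ∀ i, k ≤ i → jumpTimes x i + 1 ≤ jumpTimes x (i + 1) := by
    intro i hi
    have hai : a < jumpTimes x i := hk.trans_le (hmono.monotone hi)
    have h := min_le_jumpGap (x := x) (t := jumpTimes x i) (r := L - jumpTimes x i) (by
      intro u hu
      have h1 : x (jumpTimes x i) = l := hal ⟨hai, hltL i⟩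
      have h2 : x (jumpTimes x i + u) = l :=
        hal ⟨hai.trans_le le_self_add, by rw [add_comm]; exact lt_tsub_iff_right.1 hu⟩
      rw [h1, h2])
    rcases min_le_iff.1 h with h | h
    · have := (hltL (i + 1)).not_ge
      exact absurd (tsub_le_iff_left.1 h) this
    · exact add_le_add le_rfl h
  have hgrow : ∀ m : ℕ, (m : ℝ≥0) ≤ jumpTimes x (k + m) := by
    intro m
    induction m with
    | zero => simp
    | succ m ih =>
      push_cast
      exact (add_le_add ih le_rfl).trans (hconst (k + m) (by omega))
  obtain ⟨m, hm⟩ := exists_nat_gt L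
  exact absurd (hm.trans_le (hgrow m)) (hltL _).not_gt

theorem stepPath_jumpTimes {E : Type*} [TopologicalSpace E] {g : S → E} (hg : Continuous g)
    (x : SkorokhodSpace S) :
    x.map g hg = stepPath g (fun k => x (jumpTimes x k), jumpTimes x) := by
  refine Subtype.ext (funext fun t => ?_)
  have hx := jumpTimes_mem x.2
  obtain ⟨i, h1, h2⟩ := exists_mem_step hx t
  rw [stepPath_apply g (p := (fun k => x (jumpTimes x k), jumpTimes x)) hx h1 h2]
  change g (x t) = g (x (jumpTimes x i))
  have h3 : t - jumpTimes x i < jumpGap x (jumpTimes x i) := by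
    rw [tsub_lt_iff_left h1]; exact h2
  have := eq_of_lt_jumpGap x.2 h3
  rw [add_tsub_cancel_of_le h1] at this
  rw [this]

end JumpTimes

/-! ### Measurability and tightness of a single law -/

section Measurability

variable {Ω S : Type*} [MeasurableSpace Ω] [TopologicalSpace S] [DiscreteTopology S]
  [MeasurableSpace S] [BorelSpace S]

/-- Approximate `σ` from the right by times on the grid of mesh `1 / (m + 1)` and use
right-continuity. -/
theorem measurable_eval_comp {X : Ω → SkorokhodSpace S} (hX : ∀ t, Measurable fun ω => X ω t)
    {σ : Ω → ℝ≥0} (hσ : Measurable σ) : Measurable fun ω => X ω (σ ω) := by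
  let d : ℕ → ℝ≥0 → ℝ≥0 := fun m t => ((⌊(m + 1) * t⌋₊ : ℝ≥0) + 1) / (m + 1)
  have hm : ∀ m, Measurable fun ω => X ω (d m (σ ω)) := by
    intro m
    have h1 : Measurable fun p : Ω × ℕ => X p.1 (((p.2 : ℝ≥0) + 1) / (m + 1)) :=
      measurable_from_prod_countable_left fun j => hX (((j : ℝ≥0) + 1) / (m + 1))
    have h2 : Measurable fun ω => ⌊((m : ℝ≥0) + 1) * σ ω⌋₊ :=
      Nat.measurable_floor.comp (hσ.const_mul _)
    exact h1.comp (measurable_id.prodMk h2)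
  refine measurable_of_tendsto_metrizable hm ?_
  rw [tendsto_pi_nhds]
  intro ω
  have h := ((X ω).2 (σ ω)).1
  refine h.tendsto.comp (tendsto_nhdsWithin_iff.2 ⟨?_, Eventually.of_forall fun m => ?_⟩)
  · refine tendsto_of_tendsto_of_tendsto_of_le_of_le' tendsto_const_nhds
      (h := fun m : ℕ => σ ω + 1 / ((m : ℝ≥0) + 1)) ?_ ?_ ?_
    · have := (tendsto_one_div_add_atTop_nhds_zero_nat (𝕜 := ℝ≥0)).const_add (σ ω)
      simpa using this
    · refine Eventually.of_forall fun m => ?_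
      rw [le_div_iff₀ (by positivity), mul_comm]
      exact (Nat.lt_floor_add_one _).le
    · refine Eventually.of_forall fun m => ?_
      rw [div_le_iff₀ (by positivity), add_mul (σ ω) _ ((m : ℝ≥0) + 1),
        div_mul_cancel₀ _ (by positivity), mul_comm (σ ω)]
      exact add_le_add (Nat.floor_le zero_le) le_rfl
  · change σ ω ≤ _
    rw [le_div_iff₀ (by positivity), mul_comm]
    exact (Nat.lt_floor_add_one _).le

variable [Countable S]

theorem measurable_jumpTimes {X : Ω → SkorokhodSpace S} (hX : ∀ t, Measurable fun ω => X ω t)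
    (k : ℕ) : Measurable fun ω => jumpTimes (X ω : ℝ≥0 → S) k := by
  induction k with
  | zero => exact measurable_const
  | succ k ih =>
    refine ih.add (Measurable.iInf fun q => ?_)
    exact Measurable.ite (measurableSet_eq_fun (measurable_eval_comp hX (ih.add_const _))
      (measurable_eval_comp hX ih)) measurable_const measurable_const

/-- The jump-time encoding of a process. -/
noncomputable def jumpEncoding (X : Ω → SkorokhodSpace S) (ω : Ω) : (ℕ → S) × (ℕ → ℝ≥0) :=
  (fun k => X ω (jumpTimes (X ω : ℝ≥0 → S) k), jumpTimes (X ω : ℝ≥0 → S))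

theorem measurable_jumpEncoding {X : Ω → SkorokhodSpace S}
    (hX : ∀ t, Measurable fun ω => X ω t) : Measurable (jumpEncoding X) :=
  (measurable_pi_lambda _ fun k => measurable_eval_comp hX (measurable_jumpTimes hX k)).prodMk
    (measurable_pi_lambda _ fun k => measurable_jumpTimes hX k)

variable {E : Type*} [PseudoMetricSpace E] {g : S → E} (hg : Continuous g)

/-- The process factors through its encoding, which takes values where decoding is continuous. -/
theorem measurable_map_of_discrete {X : Ω → SkorokhodSpace S}
    (hX : ∀ t, Measurable fun ω => X ω t) : Measurable fun ω => (X ω).map g hg := by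
  refine measurable_of_isOpen fun O hO => ?_
  obtain ⟨u, hu, h⟩ := (continuousOn_iff'.1 (continuousOn_stepPath g)) O hO
  have : (fun ω => (X ω).map g hg) ⁻¹' O = jumpEncoding X ⁻¹' u := by
    ext ω
    have h1 := Set.ext_iff.1 h (jumpEncoding X ω)
    have h2 : (jumpEncoding X ω).2 ∈ divergentTimes := jumpTimes_mem (X ω).2
    change (X ω).map g hg ∈ O ↔ _
    rw [stepPath_jumpTimes hg]
    change stepPath g (jumpEncoding X ω) ∈ O ↔ _
    simpa [h2] using h1
  rw [this]
  exact measurable_jumpEncoding hX hu.measurableSet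

/-- The law of the encoding lives on a Polish space, so a compact subset of the valid encodings
carries all but `ε` of it; its image under decoding is compact. No completeness of the path space is
needed. -/
theorem isTightMeasureSet_map_of_discrete (μ : Measure Ω) [IsFiniteMeasure μ]
    {X : Ω → SkorokhodSpace S} (hX : ∀ t, Measurable fun ω => X ω t) :
    IsTightMeasureSet {μ.map fun ω => (X ω).map g hg} := by
  rw [isTightMeasureSet_iff_exists_isCompact_measure_compl_le]
  intro ε hε
  have hZ := measurable_jumpEncoding hX
  have hW : MeasurableSet {p : (ℕ → S) × (ℕ → ℝ≥0) | p.2 ∈ divergentTimes} :=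
    measurable_snd measurableSet_divergentTimes
  obtain ⟨K, hKW, hK, hKε⟩ := hW.exists_isCompact_sdiff_lt (μ := μ.map (jumpEncoding X))
    (measure_ne_top _ _) hε.ne'
  refine ⟨closure (stepPath g '' K),
    (hK.image_of_continuousOn ((continuousOn_stepPath g).mono hKW)).closure, ?_⟩
  rintro _ rfl
  rw [Measure.map_apply (measurable_map_of_discrete hg hX) isClosed_closure.measurableSet.compl]
  refine le_trans (measure_mono fun ω hω => ?_)
    ((Measure.le_map_apply hZ.aemeasurable _).trans hKε.le)
  refine ⟨jumpTimes_mem (X ω).2, fun hmem => hω (subset_closure ?_)⟩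
  change (X ω).map g hg ∈ _
  rw [stepPath_jumpTimes hg]
  exact mem_image_of_mem _ hmem

end Measurability

/-! ### Transition operators with bounded rates -/

namespace IsTransitionFunction

variable {E : Type*} {r : E → E → ℝ} {p : ℝ≥0 → E → E → ℝ}

theorem summable (hp : IsTransitionFunction r p) (t : ℝ≥0) (x : E) : Summable (p t x) :=
  (hp.hasSum_one t x).summable

theorem tsum_eq_one (hp : IsTransitionFunction r p) (t : ℝ≥0) (x : E) : ∑' y, p t x y = 1 :=
  (hp.hasSum_one t x).tsum_eq

theorem le_one (hp : IsTransitionFunction r p) (t : ℝ≥0) (x y : E) : p t x y ≤ 1 :=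
  le_hasSum (hp.hasSum_one t x) y fun z _ => hp.nonneg t x z

theorem mul_le_add (hp : IsTransitionFunction r p) (s t : ℝ≥0) (x : E) :
    p s x x * p t x x ≤ p (s + t) x x :=
  le_hasSum (hp.chapman_kolmogorov s t x x) x fun _ _ => mul_nonneg (hp.nonneg _ _ _) (hp.nonneg _ _ _)

theorem pow_le_nsmul (hp : IsTransitionFunction r p) (s : ℝ≥0) (x : E) (n : ℕ) :
    p s x x ^ n ≤ p (n * s) x x := by
  induction n with
  | zero => simp [hp.zero_self]
  | succ n ih =>
    rw [pow_succ]
    push_cast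
    rw [add_mul, one_mul]
    exact (mul_le_mul_of_nonneg_right ih (hp.nonneg _ _ _)).trans (hp.mul_le_add _ _ _)

theorem tendsto_div_nat {s : ℝ≥0} (hs : 0 < s) :
    Tendsto (fun n : ℕ => s / ((n : ℝ≥0) + 1)) atTop (𝓝[>] 0) := by
  refine tendsto_nhdsWithin_iff.2 ⟨?_, Eventually.of_forall fun n => ?_⟩
  · have := (tendsto_one_div_add_atTop_nhds_zero_nat (𝕜 := ℝ≥0)).const_mul s
    simpa only [mul_one_div, mul_zero] using this
  · exact div_pos hs (by positivity)

/-- By Bernoulli, `p s x x ≥ (p (s / n) x x) ^ n ≥ 1 - n (1 - p (s / n) x x)`; let `n → ∞`. -/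
theorem one_sub_self_le (hp : IsTransitionFunction r p) (s : ℝ≥0) (x : E) :
    1 - p s x x ≤ s * ∑' z : {z // z ≠ x}, r x z := by
  rcases eq_or_ne s 0 with rfl | hs
  · simp [hp.zero_self]
  have hs' : 0 < s := pos_iff_ne_zero.2 hs
  have hlim := ((hp.intensity_self x).comp (tendsto_div_nat hs')).const_mul (s : ℝ)
  refine ge_of_tendsto' hlim fun n => ?_
  have h1 := hp.pow_le_nsmul (s / ((n : ℝ≥0) + 1)) x (n + 1)
  have h2 : ((n + 1 : ℕ) : ℝ≥0) * (s / ((n : ℝ≥0) + 1)) = s := by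
    push_cast
    rw [mul_div_cancel₀]
    positivity
  rw [h2] at h1
  set a := p (s / ((n : ℝ≥0) + 1)) x x with ha
  have h3 := one_add_mul_le_pow (a := a - 1) (by linarith [hp.nonneg (s / ((n : ℝ≥0) + 1)) x x]) (n + 1)
  rw [add_sub_cancel] at h3
  have h4 : (s : ℝ) * ((1 - a) / ((s / ((n : ℝ≥0) + 1) : ℝ≥0) : ℝ)) = ((n + 1 : ℕ) : ℝ) * (1 - a) := by
    have : (s : ℝ) ≠ 0 := by exact_mod_cast hs
    push_cast
    field_simp
  change 1 - p s x x ≤ (s : ℝ) * ((1 - a) / ((s / ((n : ℝ≥0) + 1) : ℝ≥0) : ℝ))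
  rw [h4]
  linarith

/-- The transition operator. -/
noncomputable def semigroup (p : ℝ≥0 → E → E → ℝ) (t : ℝ≥0) (f : E → ℝ) (x : E) : ℝ :=
  ∑' y, p t x y * f y

theorem summable_mul (hp : IsTransitionFunction r p) (t : ℝ≥0) (x : E) {f : E → ℝ} {B : ℝ}
    (hf : ∀ y, |f y| ≤ B) : Summable fun y => p t x y * f y := by
  refine Summable.of_norm_bounded ((hp.summable t x).mul_right B) fun y => ?_
  rw [Real.norm_eq_abs, abs_mul, abs_of_nonneg (hp.nonneg _ _ _)]
  exact mul_le_mul_of_nonneg_left (hf y) (hp.nonneg _ _ _)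

theorem hasSum_semigroup_sub (hp : IsTransitionFunction r p) (t : ℝ≥0) (x : E) {f : E → ℝ} {B : ℝ}
    (hf : ∀ y, |f y| ≤ B) :
    HasSum (fun y => p t x y * (f y - f x)) (semigroup p t f x - f x) := by
  have h1 := (hp.summable_mul t x hf).hasSum
  have h2 := (hp.hasSum_one t x).mul_right (f x)
  rw [one_mul] at h2
  simp only [mul_sub]
  exact h1.sub h2

/-- The right-hand factor is the mass sent outside `S` and `x`, where `f` differs from `f x` by at
most `2 B`. -/
theorem abs_semigroup_sub_sum_le (hp : IsTransitionFunction r p) (t : ℝ≥0) (x : E) {f : E → ℝ}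
    {B : ℝ} (hf : ∀ y, |f y| ≤ B) (S : Finset E) (hxS : x ∉ S) :
    |semigroup p t f x - f x - ∑ y ∈ S, p t x y * (f y - f x)| ≤
      2 * B * (1 - p t x x - ∑ y ∈ S, p t x y) := by
  classical
  have h1 := hp.hasSum_semigroup_sub t x hf
  have h2 : HasSum (fun y => if y ∈ S then p t x y * (f y - f x) else 0)
      (∑ y ∈ S, p t x y * (f y - f x)) := by
    rw [← Finset.sum_congr rfl (g := fun y => p t x y * (f y - f x))
      (f := fun y => if y ∈ S then p t x y * (f y - f x) else 0) (fun y hy => if_pos hy)]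
    exact hasSum_sum_of_ne_finset_zero fun y hy => if_neg hy
  have h3 : HasSum (fun y => if y ∈ S then p t x y else 0) (∑ y ∈ S, p t x y) := by
    rw [← Finset.sum_congr rfl (g := fun y => p t x y)
      (f := fun y => if y ∈ S then p t x y else 0) (fun y hy => if_pos hy)]
    exact hasSum_sum_of_ne_finset_zero fun y hy => if_neg hy
  have h4 := (((hp.hasSum_one t x).sub (hasSum_ite_eq x (p t x x))).sub h3).mul_left (2 * B)
  have hB : 0 ≤ B := (abs_nonneg _).trans (hf x)
  have hle : ∀ y, |p t x y * (f y - f x) - (if y ∈ S then p t x y * (f y - f x) else 0)| ≤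
      2 * B * (p t x y - (if y = x then p t x x else 0) - (if y ∈ S then p t x y else 0)) := by
    intro y
    by_cases hyS : y ∈ S
    · have : y ≠ x := fun h => hxS (h ▸ hyS)
      simp [hyS, this]
    · by_cases hyx : y = x
      · subst hyx; simp [hyS]
      · simp only [hyS, hyx, if_false, sub_zero]
        rw [abs_mul, abs_of_nonneg (hp.nonneg _ _ _), mul_comm]
        refine mul_le_mul_of_nonneg_right ?_ (hp.nonneg _ _ _)
        have h5 := hf x
        have h6 := hf y
        rw [abs_le] at h5 h6 ⊢
        constructor <;> linarith
  have h5 := h1.sub h2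
  rw [abs_le]
  constructor
  · rw [← sub_nonneg]
    have := h5.add h4
    rw [sub_neg_eq_add]
    exact this.nonneg fun y => by have := neg_le_of_abs_le (hle y); linarith
  · exact hasSum_le (fun y => le_of_abs_le (hle y)) h5 h4

theorem abs_semigroup_sub_le (hp : IsTransitionFunction r p) (t : ℝ≥0) (x : E) {f : E → ℝ}
    {B Λ : ℝ} (hΛ : ∑' z : {z // z ≠ x}, r x z ≤ Λ) (hf : ∀ y, |f y| ≤ B) :
    |semigroup p t f x - f x| ≤ 2 * B * (t * Λ) := by
  have h := hp.abs_semigroup_sub_sum_le t x hf ∅ (Finset.notMem_empty _)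
  simp only [Finset.sum_empty, sub_zero] at h
  have hB : 0 ≤ B := (abs_nonneg _).trans (hf x)
  refine h.trans (mul_le_mul_of_nonneg_left ?_ (by linarith))
  exact (hp.one_sub_self_le t x).trans (mul_le_mul_of_nonneg_left hΛ t.2)

theorem abs_semigroup_le (hp : IsTransitionFunction r p) (t : ℝ≥0) (x : E) {f : E → ℝ}
    {B : ℝ} (hf : ∀ y, |f y| ≤ B) : |semigroup p t f x| ≤ B := by
  have h1 := (hp.summable_mul t x hf).hasSum
  have h2 := (hp.hasSum_one t x).mul_right B
  rw [one_mul] at h2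
  have hle : ∀ y, |p t x y * f y| ≤ p t x y * B := fun y => by
    rw [abs_mul, abs_of_nonneg (hp.nonneg _ _ _)]
    exact mul_le_mul_of_nonneg_left (hf y) (hp.nonneg _ _ _)
  rw [abs_le]
  refine ⟨?_, hasSum_le (fun y => le_of_abs_le (hle y)) h1 h2⟩
  exact hasSum_le (fun y => neg_le_of_abs_le (hle y)) h2.neg h1

theorem semigroup_add (hp : IsTransitionFunction r p) (s t : ℝ≥0) (x : E) {f : E → ℝ} {B : ℝ}
    (hf : ∀ y, |f y| ≤ B) : semigroup p (s + t) f x = semigroup p s (semigroup p t f) x := by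
  have hB : 0 ≤ B := (abs_nonneg _).trans (hf x)
  have h0 : Summable fun q : E × E => p s x q.1 * p t q.1 q.2 * B := by
    have hnn : 0 ≤ fun q : E × E => p s x q.1 * p t q.1 q.2 * B := fun q =>
      mul_nonneg (mul_nonneg (hp.nonneg s x q.1) (hp.nonneg t q.1 q.2)) hB
    rw [summable_prod_of_nonneg hnn]
    refine ⟨fun z => ?_, ?_⟩
    · exact ((hp.summable t z).mul_left (p s x z)).mul_right B
    · simp only [tsum_mul_right, tsum_mul_left, hp.tsum_eq_one, mul_one]
      exact (hp.summable s x).mul_right B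
  have h1 : Summable fun q : E × E => p s x q.1 * p t q.1 q.2 * f q.2 := by
    refine Summable.of_norm_bounded h0 fun q => ?_
    have hnn := mul_nonneg (hp.nonneg s x q.1) (hp.nonneg t q.1 q.2)
    rw [Real.norm_eq_abs, abs_mul, abs_of_nonneg hnn]
    exact mul_le_mul_of_nonneg_left (hf _) hnn
  have h2 := Summable.tsum_comm (f := fun z y => p s x z * p t z y * f y) h1
  simp only [semigroup]
  rw [tsum_congr fun y => by rw [← (hp.chapman_kolmogorov s t x y).tsum_eq, ← tsum_mul_right], h2]
  exact tsum_congr fun z => by rw [← tsum_mul_left]; exact tsum_congr fun y => by ring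

variable {Λ : ℝ}

/-- The generator, for intensities with finite support. -/
def generator (r : E → E → ℝ) (S : E → Finset E) (f : E → ℝ) (x : E) : ℝ :=
  ∑ y ∈ S x, r x y * (f y - f x)

theorem tsum_intensity {S : E → Finset E} (hxS : ∀ x, x ∉ S x)
    (hr : ∀ x y, y ≠ x → y ∉ S x → r x y = 0) (x : E) :
    ∑' z : {z // z ≠ x}, r x z = ∑ y ∈ S x, r x y := by
  classical
  rw [show ∑' z : {z // z ≠ x}, r x z = ∑' z, {z | z ≠ x}.indicator (r x) z from
    tsum_subtype {z | z ≠ x} (r x)]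
  rw [tsum_eq_sum (s := S x)]
  · refine Finset.sum_congr rfl fun y hy => ?_
    exact indicator_of_mem (show y ∈ {z | z ≠ x} from fun h => hxS x (h ▸ hy)) _
  · intro y hy
    by_cases hyx : y = x
    · exact indicator_of_notMem (show y ∉ {z | z ≠ x} from fun h => h hyx) _
    · rw [indicator_of_mem (show y ∈ {z | z ≠ x} from hyx)]
      exact hr x y hyx hy

/-- The mass sent outside `S x` and `x` is `o(t)`, because the exit rate equals the sum of the rates
into `S x`. -/
theorem tendsto_generator (hp : IsTransitionFunction r p) {S : E → Finset E}
    (hxS : ∀ x, x ∉ S x) (hr : ∀ x y, y ≠ x → y ∉ S x → r x y = 0)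
    {f : E → ℝ} {B : ℝ} (hf : ∀ y, |f y| ≤ B) (x : E) :
    Tendsto (fun t : ℝ≥0 => (semigroup p t f x - f x) / (t : ℝ)) (𝓝[>] 0)
      (𝓝 (generator r S f x)) := by
  have h1 : Tendsto (fun t : ℝ≥0 => ∑ y ∈ S x, p t x y / (t : ℝ) * (f y - f x)) (𝓝[>] 0)
      (𝓝 (generator r S f x)) :=
    tendsto_finsetSum _ fun y hy =>
      (hp.intensity x y fun h => hxS x (h ▸ hy)).mul_const _
  have h2 : Tendsto (fun t : ℝ≥0 => 2 * B * ((1 - p t x x) / (t : ℝ) -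
      ∑ y ∈ S x, p t x y / (t : ℝ))) (𝓝[>] 0) (𝓝 0) := by
    have h3 := (((hp.intensity_self x).sub (tendsto_finsetSum (S x) fun y hy =>
      hp.intensity x y fun h => hxS x (h ▸ hy))).const_mul (2 * B))
    rwa [tsum_intensity hxS hr, sub_self, mul_zero] at h3
  have h3 : Tendsto (fun t : ℝ≥0 => (semigroup p t f x - f x) / (t : ℝ) -
      ∑ y ∈ S x, p t x y / (t : ℝ) * (f y - f x)) (𝓝[>] 0) (𝓝 0) := by
    refine squeeze_zero_norm' ?_ h2
    filter_upwards [self_mem_nhdsWithin] with t ht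
    have ht' : (0 : ℝ) < t := by exact_mod_cast ht
    have h := hp.abs_semigroup_sub_sum_le t x hf (S x) (hxS x)
    rw [← div_le_div_iff_of_pos_right ht'] at h
    rw [Real.norm_eq_abs]
    calc _ = |semigroup p t f x - f x - ∑ y ∈ S x, p t x y * (f y - f x)| / t := by
          rw [← abs_of_pos ht', ← abs_div, abs_of_pos ht', sub_div (_ - _),
            Finset.sum_div]
          congr 2
          exact Finset.sum_congr rfl fun y _ => by ring
      _ ≤ _ := h
      _ = _ := by rw [mul_div_assoc, sub_div, Finset.sum_div]
  have h4 := h3.add h1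
  rw [zero_add] at h4
  simpa using h4

/-- Telescope: step `n + 1` contributes the transition operator at time `n ε` applied to `g`, where
`g` is the one-step increment. Since `g` is of order `ε Λ`, replacing this by `g` itself costs one
more factor `n ε Λ`. -/
theorem abs_semigroup_nat_sub_le (hp : IsTransitionFunction r p)
    (hΛ : ∀ x, ∑' z : {z // z ≠ x}, r x z ≤ Λ)
    {f : E → ℝ} {B : ℝ} (hf : ∀ y, |f y| ≤ B) (ε : ℝ≥0) (x : E) (n : ℕ) :
    |semigroup p (n * ε) f x - f x - n * (semigroup p ε f x - f x)| ≤
      n * (2 * (2 * B * (ε * Λ)) * (n * ε * Λ)) := by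
  have hB : 0 ≤ B := (abs_nonneg _).trans (hf x)
  have hΛ0 : 0 ≤ ε * Λ := by
    refine le_trans ?_ (mul_le_mul_of_nonneg_left (hΛ x) ε.2)
    exact le_trans (by linarith [hp.le_one ε x x]) (hp.one_sub_self_le ε x)
  induction n with
  | zero =>
    have : semigroup p 0 f x - f x = 0 := by
      have h := hp.abs_semigroup_sub_le 0 x (hΛ x) hf
      simpa using h
    simp [this]
  | succ n ih =>
    set g : E → ℝ := fun y => semigroup p ε f y - f y with hg
    have hgB : ∀ y, |g y| ≤ 2 * B * (ε * Λ) := fun y => hp.abs_semigroup_sub_le ε y (hΛ y) hf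
    have h1 := hp.abs_semigroup_sub_le (n * ε) x (hΛ x) hgB
    have h2 : semigroup p ((n + 1 : ℕ) * ε) f x = semigroup p (n * ε) f x + semigroup p (n * ε) g x := by
      push_cast
      rw [add_mul, one_mul, hp.semigroup_add _ _ _ hf]
      simp only [semigroup]
      rw [← (hp.summable_mul (n * ε) x hf).tsum_add (hp.summable_mul (n * ε) x hgB)]
      refine tsum_congr fun y => ?_
      simp only [hg, semigroup]
      ring
    rw [h2]
    push_cast at h1 ⊢
    have h3 : semigroup p (n * ε) f x + semigroup p (n * ε) g x - f x -
        ((n : ℝ) + 1) * (semigroup p ε f x - f x) =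
        (semigroup p (n * ε) f x - f x - n * (semigroup p ε f x - f x)) +
        (semigroup p (n * ε) g x - g x) := by
      simp only [hg]; ring
    rw [h3]
    refine (abs_add_le _ _).trans ((add_le_add ih h1).trans ?_)
    have h4 : 0 ≤ 2 * (2 * B * (ε * Λ)) := by positivity
    have hn : (0 : ℝ) ≤ n := by positivity
    nlinarith [mul_nonneg h4 hΛ0, mul_nonneg (mul_nonneg h4 hΛ0) hn]

/-- Second order bound for the transition operator at bounded functions. -/
theorem abs_semigroup_sub_generator_le (hp : IsTransitionFunction r p) {S : E → Finset E}
    (hxS : ∀ x, x ∉ S x) (hr : ∀ x y, y ≠ x → y ∉ S x → r x y = 0)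
    (hΛ : ∀ x, ∑ y ∈ S x, r x y ≤ Λ)
    {f : E → ℝ} {B : ℝ} (hf : ∀ y, |f y| ≤ B) (h : ℝ≥0) (x : E) :
    |semigroup p h f x - f x - h * generator r S f x| ≤ 4 * B * (h * Λ) ^ 2 := by
  have hΛ' : ∀ x, ∑' z : {z // z ≠ x}, r x z ≤ Λ := fun x => by
    rw [tsum_intensity hxS hr]; exact hΛ x
  rcases eq_or_ne h 0 with rfl | hh
  · have := hp.abs_semigroup_sub_le 0 x (hΛ' x) hf
    simpa using this
  have hh' : 0 < h := pos_iff_ne_zero.2 hh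
  -- Cut `h` into `n + 1` steps: the scaled one-step increment tends to the generator, while the
  -- error bound does not depend on `n`.
  have hlim := (((hp.tendsto_generator hxS hr hf x).comp (tendsto_div_nat hh')).const_mul
    (h : ℝ)).const_sub (semigroup p h f x - f x)
  refine le_of_tendsto' hlim.abs fun n => ?_
  have h1 := hp.abs_semigroup_nat_sub_le hΛ' hf (h / ((n : ℝ≥0) + 1)) x (n + 1)
  have h2 : ((n + 1 : ℕ) : ℝ≥0) * (h / ((n : ℝ≥0) + 1)) = h := by
    push_cast
    rw [mul_div_cancel₀]
    positivity
  rw [h2] at h1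
  have hr0 : (h : ℝ) ≠ 0 := by exact_mod_cast hh
  have hn0 : (n : ℝ) + 1 ≠ 0 := by positivity
  have h3 : ((n + 1 : ℕ) : ℝ) * ((h / ((n : ℝ≥0) + 1) : ℝ≥0) : ℝ) = h := by exact_mod_cast h2
  have h4 : ((h / ((n : ℝ≥0) + 1) : ℝ≥0) : ℝ) = h / ((n : ℝ) + 1) := by push_cast; rfl
  have h5 : (h : ℝ) * ((semigroup p (h / ((n : ℝ≥0) + 1)) f x - f x) /
      ((h / ((n : ℝ≥0) + 1) : ℝ≥0) : ℝ)) =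
      ((n + 1 : ℕ) : ℝ) * (semigroup p (h / ((n : ℝ≥0) + 1)) f x - f x) := by
    rw [h4]
    push_cast
    field_simp
  change |_ - (h : ℝ) * ((semigroup p (h / ((n : ℝ≥0) + 1)) f x - f x) /
      ((h / ((n : ℝ≥0) + 1) : ℝ≥0) : ℝ))| ≤ _
  rw [h5]
  refine h1.trans (le_of_eq ?_)
  rw [show ((n + 1 : ℕ) : ℝ) * (2 * (2 * B * (((h / ((n : ℝ≥0) + 1) : ℝ≥0) : ℝ) * Λ)) *
    (((n + 1 : ℕ) : ℝ) * ((h / ((n : ℝ≥0) + 1) : ℝ≥0) : ℝ) * Λ)) =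
    4 * B * (((n + 1 : ℕ) : ℝ) * ((h / ((n : ℝ≥0) + 1) : ℝ≥0) : ℝ) * Λ) ^ 2 by ring, h3]

end IsTransitionFunction

/-! ### The Markov property for past-dependent functions -/

section Markov

variable {Ω E : Type*} [MeasurableSpace Ω] [TopologicalSpace E] [MeasurableSpace E]
  {μ : ProbabilityMeasure Ω} {r : E → E → ℝ} {x₀ : E} {X : Ω → SkorokhodSpace E}

theorem pathHistory_le (hX : ∀ t : ℝ≥0, Measurable fun ω => X ω t) (s : ℝ≥0) :
    pathHistory X s ≤ (inferInstance : MeasurableSpace Ω) :=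
  iSup₂_le fun u _ => (hX u).comap_le

omit [MeasurableSpace Ω] in
theorem measurable_pathHistory {u s : ℝ≥0} (hus : u ≤ s) :
    Measurable[pathHistory X s] fun ω => X ω u := by
  refine Measurable.of_comap_le ?_
  exact le_iSup₂_of_le (f := fun u (_ : u ∈ Iic s) => MeasurableSpace.comap (fun ω => X ω u) inferInstance)
    u hus le_rfl

/-- Split by the value `y` of `X (s + t)`: on each piece `F · y` is known at time `s` and leaves the
conditional expectation. -/
theorem integral_eval_eq_integral_semigroup [Countable E] [MeasurableSingletonClass E]
    (hX : ∀ t : ℝ≥0, Measurable fun ω => X ω t) {p : ℝ≥0 → E → E → ℝ}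
    (hp : IsTransitionFunction r p)
    (hmk : ∀ (s t : ℝ≥0) (y : E),
      (μ : Measure Ω)[{ω | X ω (s + t) = y}.indicator (fun _ => (1 : ℝ)) | pathHistory X s]
        =ᵐ[(μ : Measure Ω)] fun ω => p t (X ω s) y)
    (s t : ℝ≥0) {F : Ω → E → ℝ} {B : ℝ} (hFB : ∀ ω y, |F ω y| ≤ B)
    (hF : ∀ y, Measurable[pathHistory X s] fun ω => F ω y) :
    ∫ ω, F ω (X ω (s + t)) ∂(μ : Measure Ω) =
      ∫ ω, IsTransitionFunction.semigroup p t (F ω) (X ω s) ∂(μ : Measure Ω) := by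
  have hle := pathHistory_le hX s
  have hF' : ∀ y, Measurable fun ω => F ω y := fun y => (hF y).mono hle le_rfl
  have hpm : ∀ y, Measurable fun ω => p t (X ω s) y := fun y =>
    (measurable_of_countable fun x => p t x y).comp (hX s)
  have hset : ∀ y, MeasurableSet {ω | X ω (s + t) = y} := fun y => hX _ (measurableSet_singleton y)
  have hG : Measurable fun ω => F ω (X ω (s + t)) := by
    have h1 : Measurable fun q : Ω × E => F q.1 q.2 := measurable_from_prod_countable_left hF'
    exact h1.comp (measurable_id.prodMk (hX (s + t)))
  have hGi : Integrable (fun ω => F ω (X ω (s + t))) (μ : Measure Ω) :=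
    Integrable.of_bound hG.aestronglyMeasurable B (Eventually.of_forall fun ω => hFB _ _)
  have hy : ∀ y, ∫ ω in {ω | X ω (s + t) = y}, F ω (X ω (s + t)) ∂(μ : Measure Ω) =
      ∫ ω, p t (X ω s) y * F ω y ∂(μ : Measure Ω) := by
    intro y
    set g : Ω → ℝ := {ω | X ω (s + t) = y}.indicator (fun _ => (1 : ℝ)) with hg
    have hgi : Integrable g (μ : Measure Ω) := (integrable_const 1).indicator (hset y)
    have hfgi : Integrable ((fun ω => F ω y) * g) (μ : Measure Ω) := by
      refine Integrable.of_bound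
        ((hF' y).mul (measurable_const.indicator (hset y))).aestronglyMeasurable B
        (Eventually.of_forall fun ω => ?_)
      have hB : 0 ≤ B := (abs_nonneg _).trans (hFB ω y)
      by_cases h : X ω (s + t) = y
      · simpa [hg, h] using hFB ω y
      · simpa [hg, h] using hB
    have h1 := condExp_mul_of_stronglyMeasurable_left (hF y).stronglyMeasurable hfgi hgi
    have h2 : (μ : Measure Ω)[(fun ω => F ω y) * g | pathHistory X s] =ᵐ[(μ : Measure Ω)]
        fun ω => p t (X ω s) y * F ω y := by
      filter_upwards [h1, hmk s t y] with ω ha hb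
      rw [ha, Pi.mul_apply, hb, mul_comm]
    rw [← integral_congr_ae h2, integral_condExp hle, ← integral_indicator (hset y)]
    refine integral_congr_ae (Eventually.of_forall fun ω => ?_)
    by_cases h : X ω (s + t) = y
    · simp [hg, h]
    · simp [hg, h]
  have h1 := hasSum_integral_iUnion (μ := (μ : Measure Ω)) hset (by
      intro y z hyz
      refine Set.disjoint_left.2 fun ω h h' => hyz ?_
      exact (show X ω (s + t) = y from h).symm.trans h') hGi.integrableOn
  have hU : (⋃ y, {ω | X ω (s + t) = y}) = univ :=
    eq_univ_of_forall fun ω => mem_iUnion.2 ⟨_, rfl⟩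
  rw [hU, Measure.restrict_univ] at h1
  simp only [hy] at h1
  have h2 := hasSum_integral_of_dominated_convergence (μ := (μ : Measure Ω))
    (F := fun y ω => p t (X ω s) y * F ω y)
    (f := fun ω => IsTransitionFunction.semigroup p t (F ω) (X ω s))
    (fun y ω => p t (X ω s) y * B)
    (fun y => ((hpm y).mul (hF' y)).aestronglyMeasurable)
    (fun y => Eventually.of_forall fun ω => by
      rw [Real.norm_eq_abs, abs_mul, abs_of_nonneg (hp.nonneg _ _ _)]
      exact mul_le_mul_of_nonneg_left (hFB ω y) (hp.nonneg _ _ _))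
    (Eventually.of_forall fun ω => (hp.summable t _).mul_right B)
    (by simp only [tsum_mul_right, hp.tsum_eq_one]; exact integrable_const _)
    (Eventually.of_forall fun ω => (hp.summable_mul t _ (hFB ω)).hasSum)
  exact h1.unique h2

/-- A one-step comparison for a Markov process. -/
theorem integral_le_integral_of_semigroup_le [Countable E] [MeasurableSingletonClass E]
    (hX : ∀ t : ℝ≥0, Measurable fun ω => X ω t) {p : ℝ≥0 → E → E → ℝ}
    (hp : IsTransitionFunction r p)
    (hmk : ∀ (s t : ℝ≥0) (y : E),
      (μ : Measure Ω)[{ω | X ω (s + t) = y}.indicator (fun _ => (1 : ℝ)) | pathHistory X s]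
        =ᵐ[(μ : Measure Ω)] fun ω => p t (X ω s) y)
    (s t : ℝ≥0) {F : Ω → E → ℝ} {B : ℝ} (hFB : ∀ ω y, |F ω y| ≤ B)
    (hF : ∀ y, Measurable[pathHistory X s] fun ω => F ω y)
    {V W : Ω → ℝ} (hV : Integrable V (μ : Measure Ω)) (hW : Integrable W (μ : Measure Ω))
    (hVF : ∀ ω, V ω ≤ F ω (X ω (s + t)))
    (hFW : ∀ ω, IsTransitionFunction.semigroup p t (F ω) (X ω s) ≤ W ω) :
    ∫ ω, V ω ∂(μ : Measure Ω) ≤ ∫ ω, W ω ∂(μ : Measure Ω) := by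
  have hF' : ∀ y, Measurable fun ω => F ω y := fun y => (hF y).mono (pathHistory_le hX s) le_rfl
  have hG : Measurable fun ω => F ω (X ω (s + t)) := by
    have h1 : Measurable fun q : Ω × E => F q.1 q.2 := measurable_from_prod_countable_left hF'
    exact h1.comp (measurable_id.prodMk (hX (s + t)))
  have hGi : Integrable (fun ω => F ω (X ω (s + t))) (μ : Measure Ω) :=
    Integrable.of_bound hG.aestronglyMeasurable B (Eventually.of_forall fun ω => hFB _ _)
  have hsm : Measurable fun ω => IsTransitionFunction.semigroup p t (F ω) (X ω s) :=
    Measurable.tsum fun y => ((measurable_of_countable fun x => p t x y).comp (hX s)).mul (hF' y)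
  have hsi : Integrable (fun ω => IsTransitionFunction.semigroup p t (F ω) (X ω s))
      (μ : Measure Ω) :=
    Integrable.of_bound hsm.aestronglyMeasurable B
      (Eventually.of_forall fun ω => hp.abs_semigroup_le _ _ (hFB ω))
  refine (integral_mono hV hGi hVF).trans ?_
  rw [integral_eval_eq_integral_semigroup hX hp hmk s t hFB hF]
  exact integral_mono hsi hW hFW

end Markov

/-! ### An exponential maximal inequality on time grids -/

/-- The compensated increment of `φ` along a sequence of states, with drift `b` and time step
`h`. -/
noncomputable def noise {E : Type*} (φ b : E → ℝ) (h : ℝ) (s : ℕ → E) (k : ℕ) : ℝ :=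
  φ (s k) - φ (s 0) - h * ∑ j ∈ Finset.range k, b (s j)

theorem noise_succ {E : Type*} (φ b : E → ℝ) (h : ℝ) (s : ℕ → E) (k : ℕ) :
    noise φ b h s (k + 1) = noise φ b h s k + (φ (s (k + 1)) - φ (s k) - h * b (s k)) := by
  simp only [noise, Finset.sum_range_succ]
  ring

theorem noise_zero {E : Type*} (φ b : E → ℝ) (h : ℝ) (s : ℕ → E) : noise φ b h s 0 = 0 := by
  simp [noise]

namespace IsTransitionFunction

variable {E : Type*} {r : E → E → ℝ} {p : ℝ≥0 → E → E → ℝ} {S : E → Finset E} {Λ : ℝ}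

/-- One step of the truncated exponential supermartingale. -/
theorem semigroup_min_exp_le (hp : IsTransitionFunction r p)
    (hxS : ∀ x, x ∉ S x) (hr : ∀ x y, y ≠ x → y ∉ S x → r x y = 0)
    (hr0 : ∀ x, ∀ y ∈ S x, 0 ≤ r x y) (hΛ : ∀ x, ∑ y ∈ S x, r x y ≤ Λ)
    {φ : E → ℝ} {θ β : ℝ} {h : ℝ≥0} {x : E}
    (hβ : ∑ y ∈ S x, r x y * (Real.exp (θ * (φ y - φ x)) - 1) ≤ β)
    (hhβ : -(h * β) ≤ 1 / 2) {z M : ℝ} (hz : 0 ≤ z) (hzM : z < M) :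
    semigroup p h (fun y => min (z * Real.exp (θ * (φ y - φ x) - h * β)) (2 * M)) x ≤
      z + 8 * M * (h * Λ) ^ 2 := by
  -- The cap makes the function bounded, as the second order estimate demands. Its level `2 M`
  -- leaves the value at `x` uncut, since `exp (-(h * β)) ≤ 2`.
  set F : E → ℝ := fun y => min (z * Real.exp (θ * (φ y - φ x) - h * β)) (2 * M) with hF
  have hM : 0 < M := hz.trans_lt hzM
  have hFB : ∀ y, |F y| ≤ 2 * M := fun y => by
    rw [abs_of_nonneg (le_min (by positivity) (by positivity))]
    exact min_le_right _ _
  have h1 := le_of_abs_le (hp.abs_semigroup_sub_generator_le hxS hr hΛ hFB h x)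
  set z' := z * Real.exp (-(h * β)) with hz'
  have hz'0 : 0 ≤ z' := by positivity
  have hexp2 : Real.exp (-(h * β)) ≤ 2 := by
    refine (Real.exp_le_exp.2 hhβ).trans ?_
    have h2 : Real.exp (1 / 2) * Real.exp (1 / 2) = Real.exp 1 := by
      rw [← Real.exp_add]; norm_num
    have h3 := Real.exp_one_lt_d9
    nlinarith [Real.exp_pos (1 / 2)]
  have hFx : F x = z' := by
    simp only [hF, sub_self, mul_zero, zero_sub]
    refine min_eq_left ?_
    nlinarith [Real.exp_pos (-(h * β))]
  have hgen : generator r S F x ≤ z' * β := by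
    refine le_trans (Finset.sum_le_sum (g := fun y => z' * (r x y * (Real.exp (θ * (φ y - φ x)) - 1)))
      fun y hy => ?_) ?_
    · rw [hFx]
      have : F y ≤ z' * Real.exp (θ * (φ y - φ x)) := by
        refine (min_le_left _ _).trans (le_of_eq ?_)
        rw [hz', mul_assoc, ← Real.exp_add]
        ring_nf
      have h4 := mul_le_mul_of_nonneg_left this (hr0 x y hy)
      linarith
    · rw [← Finset.mul_sum]
      exact mul_le_mul_of_nonneg_left hβ hz'0
  -- The compensator `exp (-(h * β))` absorbs the first order growth because `1 + h β ≤ exp (h β)`.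
  have h5 : z' + h * (z' * β) ≤ z := by
    have h6 : (1 + h * β) * Real.exp (-(h * β)) ≤ 1 := by
      have h7 := Real.add_one_le_exp (h * β)
      have h8 := mul_le_mul_of_nonneg_right h7 (Real.exp_pos (-(h * β))).le
      rw [← Real.exp_add, add_neg_cancel, Real.exp_zero] at h8
      linarith
    have h9 := mul_le_mul_of_nonneg_left h6 hz
    rw [hz']
    linarith
  have h10 := mul_le_mul_of_nonneg_left hgen h.coe_nonneg
  rw [hFx] at h1
  linarith

end IsTransitionFunction

section MaximalInequality

open IsTransitionFunction

variable {Ω E : Type*} [MeasurableSpace Ω] [TopologicalSpace E] [MeasurableSpace E]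
  [Countable E] [MeasurableSingletonClass E]
  {μ : ProbabilityMeasure Ω} {r : E → E → ℝ} {x₀ : E} {X : Ω → SkorokhodSpace E}
  {S : E → Finset E} {Λ : ℝ}

/-- An exponential maximal inequality for the skeletons of a Markov jump process. -/
theorem IsMarkovJumpProcess.measure_exp_noise_ge_le (hX : IsMarkovJumpProcess μ r x₀ X)
    (hxS : ∀ x, x ∉ S x) (hr : ∀ x y, y ≠ x → y ∉ S x → r x y = 0)
    (hr0 : ∀ x, ∀ y ∈ S x, 0 ≤ r x y) (hΛ : ∀ x, ∑ y ∈ S x, r x y ≤ Λ)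
    {φ b : E → ℝ} {θ c : ℝ} {h : ℝ≥0}
    (hβ : ∀ x, ∑ y ∈ S x, r x y * (Real.exp (θ * (φ y - φ x)) - 1) ≤ θ * b x + c)
    (hhβ : ∀ x, -(h * (θ * b x + c)) ≤ 1 / 2) {M : ℝ} (hM : 0 < M) (a : ℝ≥0) (K : ℕ) :
    (μ : Measure Ω).real {ω | ∃ k ≤ K,
      M ≤ Real.exp (θ * noise φ b h (fun j => X ω (a + j * h)) k - c * (k * h))} ≤
      1 / M + 8 * K * (h * Λ) ^ 2 := by
  obtain ⟨p, hp, hmk⟩ := hX.markov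
  let Z : ℕ → Ω → ℝ := fun k ω =>
    Real.exp (θ * noise φ b h (fun j => X ω (a + j * h)) k - c * (k * h))
  have hZ0 : ∀ ω, Z 0 ω = 1 := fun ω => by simp [Z, noise_zero]
  have hZpos : ∀ k ω, 0 < Z k ω := fun k ω => Real.exp_pos _
  have hZsucc : ∀ k ω, Z (k + 1) ω = Z k ω * Real.exp (θ * (φ (X ω (a + (k + 1 : ℕ) * h)) -
      φ (X ω (a + k * h))) - h * (θ * b (X ω (a + k * h)) + c)) := fun k ω => by
    simp only [Z]
    rw [← Real.exp_add, noise_succ]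
    congr 1
    push_cast
    ring
  have hpt : ∀ (f : E → ℝ) (j k : ℕ), j ≤ k →
      Measurable[pathHistory X (a + k * h)] fun ω => f (X ω (a + j * h)) := fun f j k hjk =>
    (measurable_of_countable f).comp (measurable_pathHistory (by gcongr))
  have hZm : ∀ j k : ℕ, j ≤ k → Measurable[pathHistory X (a + k * h)] (Z j) := by
    intro j k hjk
    refine Real.measurable_exp.comp (Measurable.sub_const (Measurable.const_mul ?_ _) _)
    refine ((hpt φ j k hjk).sub (hpt φ 0 k (Nat.zero_le _))).sub (Measurable.const_mul ?_ _)
    exact Finset.measurable_fun_sum _ fun i hi =>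
      hpt b i k ((Finset.mem_range.1 hi).le.trans hjk)
  have hAm : ∀ k : ℕ, MeasurableSet[pathHistory X (a + k * h)] {ω | ∀ j ≤ k, Z j ω < M} := by
    intro k
    have : {ω | ∀ j ≤ k, Z j ω < M} = ⋂ j, ⋂ (_ : j ≤ k), {ω | Z j ω < M} := by
      ext ω; simp
    rw [this]
    refine MeasurableSet.iInter fun j => MeasurableSet.iInter fun hj => ?_
    exact hZm j k hj measurableSet_Iio
  classical
  -- The process `Z` frozen at level `M` from its first crossing on. It is bounded, and a
  -- supermartingale up to an error of order `h²` per step.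
  let V : ℕ → Ω → ℝ := fun k ω => if ∀ j ≤ k, Z j ω < M then Z k ω else M
  let F : ℕ → Ω → E → ℝ := fun k ω y => if ∀ j ≤ k, Z j ω < M then
    min (Z k ω * Real.exp (θ * (φ y - φ (X ω (a + k * h))) -
      h * (θ * b (X ω (a + k * h)) + c))) (2 * M) else M
  have hFm : ∀ (k : ℕ) y, Measurable[pathHistory X (a + k * h)] fun ω => F k ω y := by
    intro k y
    refine Measurable.ite (hAm k) (Measurable.min ((hZm k k le_rfl).mul
      (Real.measurable_exp.comp ?_)) measurable_const) measurable_const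
    exact hpt (fun x => θ * (φ y - φ x) - h * (θ * b x + c)) k k le_rfl
  have hFB : ∀ k ω y, |F k ω y| ≤ 2 * M := by
    intro k ω y
    simp only [F]
    split_ifs
    · have := hZpos k ω
      rw [abs_of_nonneg (le_min (by positivity) (by positivity))]
      exact min_le_right _ _
    · rw [abs_of_pos hM]; linarith
  have hVm : ∀ k, Measurable (V k) := fun k =>
    (Measurable.ite (hAm k) (hZm k k le_rfl) measurable_const).mono
      (pathHistory_le hX.measurable _) le_rfl
  have hV0 : ∀ k ω, 0 ≤ V k ω := fun k ω => by
    simp only [V]; split_ifs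
    · exact (hZpos _ _).le
    · exact hM.le
  have hVM : ∀ k ω, V k ω ≤ M := fun k ω => by
    simp only [V]; split_ifs with hk
    · exact (hk k le_rfl).le
    · exact le_rfl
  have hVi : ∀ k, Integrable (V k) (μ : Measure Ω) := fun k =>
    Integrable.of_bound (hVm k).aestronglyMeasurable M (Eventually.of_forall fun ω => by
      rw [Real.norm_eq_abs, abs_of_nonneg (hV0 k ω)]; exact hVM k ω)
  have hVF : ∀ k ω, V (k + 1) ω ≤ F k ω (X ω (a + k * h + h)) := by
    intro k ω
    have hidx : a + k * h + h = a + (k + 1 : ℕ) * h := by push_cast; ring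
    rw [hidx]
    simp only [V, F]
    by_cases hk : ∀ j ≤ k, Z j ω < M
    · rw [if_pos hk, ← hZsucc]
      split_ifs with hk1
      · have := hk1 (k + 1) le_rfl
        exact le_min le_rfl (by linarith)
      · refine le_min ?_ (by linarith)
        by_contra hcon
        refine hk1 fun j hj => ?_
        rcases Nat.le_succ_iff.1 hj with h' | h'
        · exact hk j h'
        · rw [h']; exact not_le.1 hcon
    · rw [if_neg hk, if_neg fun hk1 => hk fun j hj => hk1 j (hj.trans (Nat.le_succ k))]
  have hPF : ∀ k ω, semigroup p h (F k ω) (X ω (a + k * h)) ≤ V k ω + 8 * M * (h * Λ) ^ 2 := by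
    intro k ω
    by_cases hk : ∀ j ≤ k, Z j ω < M
    · simp only [V, F, if_pos hk]
      exact hp.semigroup_min_exp_le hxS hr hr0 hΛ (hβ _) (hhβ _) (hZpos _ _).le (hk k le_rfl)
    · simp only [V, F, if_neg hk, semigroup, tsum_mul_right, hp.tsum_eq_one, one_mul]
      have : 0 ≤ 8 * M * (h * Λ) ^ 2 := by positivity
      linarith
  have hstep : ∀ k, ∫ ω, V (k + 1) ω ∂(μ : Measure Ω) ≤
      ∫ ω, V k ω ∂(μ : Measure Ω) + 8 * M * (h * Λ) ^ 2 := by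
    intro k
    have h3 := integral_le_integral_of_semigroup_le hX.measurable hp hmk (a + k * h) h (hFB k)
      (hFm k) (hVi (k + 1)) ((hVi k).add (integrable_const (8 * M * (h * Λ) ^ 2))) (hVF k) (hPF k)
    simp only [Pi.add_apply] at h3
    rw [integral_add (hVi k) (integrable_const _)] at h3
    simpa only [integral_const, probReal_univ, one_smul] using h3
  have hbound : ∀ k : ℕ, ∫ ω, V k ω ∂(μ : Measure Ω) ≤ 1 + k * (8 * M * (h * Λ) ^ 2) := by
    intro k
    induction k with
    | zero =>
      have : ∀ ω, V 0 ω ≤ 1 := by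
        intro ω
        simp only [V]
        split_ifs with h0
        · exact (hZ0 ω).le
        · by_contra hcon
          refine h0 fun j hj => ?_
          rw [Nat.le_zero.1 hj, hZ0]
          exact not_le.1 hcon
      have h1 := integral_mono (hVi 0) (integrable_const (1 : ℝ)) this
      simpa using h1
    | succ k ih =>
      push_cast
      linarith [hstep k]
  have hmark := mul_meas_ge_le_integral_of_nonneg (μ := (μ : Measure Ω))
    (Eventually.of_forall (hV0 K)) (hVi K) M
  have hsub : {ω | ∃ k ≤ K, M ≤ Z k ω} ⊆ {ω | M ≤ V K ω} := by
    rintro ω ⟨k, hk, hkM⟩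
    change M ≤ V K ω
    simp only [V]
    rw [if_neg fun hall => absurd (hall k hk) (not_lt.2 hkM)]
  have hfin := (measureReal_mono (μ := (μ : Measure Ω)) hsub)
  refine hfin.trans ?_
  have h1 := hmark.trans (hbound K)
  rw [mul_comm, ← le_div_iff₀ hM] at h1
  refine h1.trans (le_of_eq ?_)
  field_simp

end MaximalInequality

/-! ### The deterministic oscillation inequality -/

section Oscillation

variable {u v A B : ℕ → ℝ} {h m₁ m₂ n₁ n₂ κ ρ : ℝ} {K : ℕ}

/-- If the first coordinate starts high enough then it stays positive, so that only one reflection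
acts. -/
theorem abs_sub_le_of_large (hh : 0 ≤ h) (hm₂ : 0 < m₂) (hn₁ : 0 ≤ n₁) (hκ : 0 ≤ κ)
    (hv0 : ∀ k, 0 ≤ v k)
    (hA0 : A 0 = 0) (hB0 : B 0 = 0) (hA : ∀ k ≤ K, |A k| ≤ κ) (hB : ∀ k ≤ K, |B k| ≤ κ)
    (hu : ∀ k, u (k + 1) = u k + (A (k + 1) - A k) +
      h * (if u k = 0 then m₁ else if v k = 0 then -n₁ else 0))
    (hv : ∀ k, v (k + 1) = v k + (B (k + 1) - B k) +
      h * (if v k = 0 then m₂ else if u k = 0 then -n₂ else 0))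
    (hhm : h * m₂ ≤ κ) (hρ : n₁ ≤ ρ * m₂) (hlarge : (1 + 2 * ρ) * κ < u 0) :
    ∀ k ≤ K, |u k - u 0| ≤ (1 + 2 * ρ) * κ ∧ |v k - v 0| ≤ 3 * κ := by
  -- Here `l` is the time spent so far with `v = 0`. It grows only when `v k = 0`; then `v 0 ≥ 0`
  -- forces `m₂ * l ≤ κ`, and one more step adds at most `κ`. Hence `u` loses at most `(1 + 2 ρ) κ`
  -- and stays positive.
  have key : ∀ k ≤ K, ∃ l, 0 ≤ l ∧ m₂ * l ≤ 2 * κ ∧ u k = u 0 + A k - n₁ * l ∧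
      v k = v 0 + B k + m₂ * l := by
    intro k
    induction k with
    | zero => intro _; exact ⟨0, le_rfl, by linarith, by rw [hA0]; ring, by rw [hB0]; ring⟩
    | succ k ih =>
      intro hk
      obtain ⟨l, hl0, hl, huk, hvk⟩ := ih (by omega)
      have hAk := abs_le.1 (hA k (by omega))
      have hBk := abs_le.1 (hB k (by omega))
      have hnl : n₁ * l ≤ ρ * (2 * κ) := by
        have h1 := mul_le_mul_of_nonneg_right hρ hl0
        have hρ0 : 0 ≤ ρ := by
          by_contra hneg
          have := mul_neg_of_neg_of_pos (not_le.1 hneg) hm₂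
          linarith
        have h2 := mul_le_mul_of_nonneg_left hl hρ0
        linarith
      have hupos : u k ≠ 0 := by
        have : 0 < u k := by rw [huk]; linarith
        exact this.ne'
      have hu' := hu k
      have hv' := hv k
      rw [if_neg hupos] at hu' hv'
      by_cases hvz : v k = 0
      · rw [if_pos hvz] at hu' hv'
        have hlk : m₂ * l ≤ κ := by linarith [hv0 0]
        exact ⟨l + h, by linarith, by linarith, by rw [hu', huk]; ring, by rw [hv', hvk]; ring⟩
      · rw [if_neg hvz] at hu' hv'
        exact ⟨l, hl0, hl, by rw [hu', huk]; ring, by rw [hv', hvk]; ring⟩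
  intro k hk
  obtain ⟨l, hl0, hl, huk, hvk⟩ := key k hk
  have hAk := abs_le.1 (hA k hk)
  have hBk := abs_le.1 (hB k hk)
  have hρ0 : 0 ≤ ρ := by
    by_contra hneg
    have := mul_neg_of_neg_of_pos (not_le.1 hneg) hm₂
    linarith
  have hnl : n₁ * l ≤ ρ * (2 * κ) := by
    have h1 := mul_le_mul_of_nonneg_right hρ hl0
    have h2 := mul_le_mul_of_nonneg_left hl hρ0
    linarith
  have hnl0 : 0 ≤ n₁ * l := mul_nonneg hn₁ hl0
  have hml0 : 0 ≤ m₂ * l := mul_nonneg hm₂.le hl0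
  have hρκ : 0 ≤ ρ * κ := mul_nonneg hρ0 hκ
  rw [abs_le, abs_le, huk, hvk]
  exact ⟨⟨by linarith, by linarith⟩, ⟨by linarith, by linarith⟩⟩

/-- A linear functional that decreases under both reflections is controlled by the noise. -/
theorem linear_le_of_noise_le (hh : 0 ≤ h) (hm₁ : 0 < m₁) (hn₂ : 0 < n₂)
    (hdir : m₁ * m₂ ≤ n₁ * n₂) (hu0 : ∀ k, 0 ≤ u k) (hv0 : ∀ k, 0 ≤ v k)
    (hA0 : A 0 = 0) (hB0 : B 0 = 0) (hA : ∀ k ≤ K, |A k| ≤ κ) (hB : ∀ k ≤ K, |B k| ≤ κ)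
    (hu : ∀ k, u (k + 1) = u k + (A (k + 1) - A k) +
      h * (if u k = 0 then m₁ else if v k = 0 then -n₁ else 0))
    (hv : ∀ k, v (k + 1) = v k + (B (k + 1) - B k) +
      h * (if v k = 0 then m₂ else if u k = 0 then -n₂ else 0))
    (hhm₁ : h * m₁ ≤ κ) (hhm₂ : h * m₂ ≤ κ) :
    ∀ k ≤ K, n₂ * u k + m₁ * v k ≤ n₂ * u 0 + m₁ * v 0 + 3 * (n₂ + m₁) * κ := by
  have hκ : 0 ≤ κ := (abs_nonneg _).trans (hA 0 (Nat.zero_le _))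
  have hL0 : 0 ≤ n₂ * u 0 + m₁ * v 0 :=
    add_nonneg (mul_nonneg hn₂.le (hu0 0)) (mul_nonneg hm₁.le (hv0 0))
  have hsum : 0 ≤ (n₂ + m₁) * κ := mul_nonneg (by linarith) hκ
  -- The push changes the functional by `0` where only `u` vanishes and by `h (m₁ m₂ - n₁ n₂) ≤ 0`
  -- where only `v` does. At the corner the induction restarts from the value `0`: the push and the
  -- noise already used cost `(n₂ + m₁) κ` each, which is the constant `2`.
  have key : ∀ k ≤ K, n₂ * u k + m₁ * v k ≤
      n₂ * A k + m₁ * B k + (n₂ * u 0 + m₁ * v 0 + 2 * (n₂ + m₁) * κ) := by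
    intro k
    induction k with
    | zero => intro _; rw [hA0, hB0]; linarith
    | succ k ih =>
      intro hk
      have ihk := ih (by omega)
      have hAk := abs_le.1 (hA k (by omega))
      have hBk := abs_le.1 (hB k (by omega))
      have hu' := hu k
      have hv' := hv k
      have e1 := mul_le_mul_of_nonneg_left hhm₁ hn₂.le
      have e2 := mul_le_mul_of_nonneg_left hhm₂ hm₁.le
      have e3 := mul_le_mul_of_nonneg_left hAk.1 hn₂.le
      have e4 := mul_le_mul_of_nonneg_left hBk.1 hm₁.le
      have e5 := mul_le_mul_of_nonneg_left hdir hh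
      by_cases huz : u k = 0 <;> by_cases hvz : v k = 0 <;>
        simp only [huz, hvz, if_true, if_false] at hu' hv' ihk <;> rw [hu', hv'] <;> linarith
  intro k hk
  have h1 := key k hk
  have e1 := mul_le_mul_of_nonneg_left (abs_le.1 (hA k hk)).2 hn₂.le
  have e2 := mul_le_mul_of_nonneg_left (abs_le.1 (hB k hk)).2 hm₁.le
  linarith

/-- The oscillation inequality: the reflected pair moves by at most a constant times the size of
the noise. -/
theorem abs_sub_le_of_noise_le (hh : 0 ≤ h) (hm₁ : 0 < m₁) (hm₂ : 0 < m₂) (hn₁ : 0 < n₁)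
    (hn₂ : 0 < n₂) (hdir : m₁ * m₂ ≤ n₁ * n₂) (hu0 : ∀ k, 0 ≤ u k) (hv0 : ∀ k, 0 ≤ v k)
    (hA0 : A 0 = 0) (hB0 : B 0 = 0) (hA : ∀ k ≤ K, |A k| ≤ κ) (hB : ∀ k ≤ K, |B k| ≤ κ)
    (hu : ∀ k, u (k + 1) = u k + (A (k + 1) - A k) +
      h * (if u k = 0 then m₁ else if v k = 0 then -n₁ else 0))
    (hv : ∀ k, v (k + 1) = v k + (B (k + 1) - B k) +
      h * (if v k = 0 then m₂ else if u k = 0 then -n₂ else 0))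
    (hhm₁ : h * m₁ ≤ κ) (hhm₂ : h * m₂ ≤ κ)
    (hρ₁ : n₁ ≤ ρ * m₂) (hρ₂ : n₂ ≤ ρ * m₁) (hρ₃ : m₁ ≤ ρ * n₂) :
    ∀ k ≤ K, |u k - u 0| ≤ (1 + ρ) * (4 + 2 * ρ) * κ ∧ |v k - v 0| ≤ (1 + ρ) * (4 + 2 * ρ) * κ := by
  have hκ : 0 ≤ κ := (abs_nonneg _).trans (hA 0 (Nat.zero_le _))
  have hρ0 : 0 ≤ ρ := by
    by_contra hneg
    have := mul_neg_of_neg_of_pos (not_le.1 hneg) hm₂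
    linarith
  have hρκ : 0 ≤ ρ * κ := mul_nonneg hρ0 hκ
  have hρρκ : 0 ≤ ρ * (ρ * κ) := mul_nonneg hρ0 hρκ
  intro k hk
  -- A high starting coordinate excludes its own reflection; two low ones give `n₂ u 0 + m₁ v 0 ≤
  -- (n₂ + m₁) (1 + 2 ρ) κ`.
  rcases lt_or_ge ((1 + 2 * ρ) * κ) (u 0) with h1 | h1
  · obtain ⟨a, b⟩ := abs_sub_le_of_large hh hm₂ hn₁.le hκ hv0 hA0 hB0 hA hB hu hv hhm₂ hρ₁ h1 k hk
    exact ⟨by linarith, by linarith⟩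
  rcases lt_or_ge ((1 + 2 * ρ) * κ) (v 0) with h2 | h2
  · obtain ⟨a, b⟩ := abs_sub_le_of_large hh hm₁ hn₂.le hκ hu0 hB0 hA0 hB hA hv hu hhm₁ hρ₂ h2 k hk
    exact ⟨by linarith, by linarith⟩
  have hL := linear_le_of_noise_le hh hm₁ hn₂ hdir hu0 hv0 hA0 hB0 hA hB hu hv hhm₁ hhm₂ k hk
  have e1 := mul_le_mul_of_nonneg_left h1 hn₂.le
  have e2 := mul_le_mul_of_nonneg_left h2 hm₁.le
  have hL' : n₂ * u k + m₁ * v k ≤ (n₂ + m₁) * ((4 + 2 * ρ) * κ) := by linarith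
  have hc : 0 ≤ (4 + 2 * ρ) * κ := by linarith
  -- Since `v k ≥ 0`, dividing the bound by `n₂` costs the factor `1 + m₁ / n₂ ≤ 1 + ρ`.
  have huk : u k ≤ (1 + ρ) * ((4 + 2 * ρ) * κ) := by
    have h3 : n₂ * u k ≤ n₂ * ((1 + ρ) * ((4 + 2 * ρ) * κ)) := by
      have := mul_nonneg hm₁.le (hv0 k)
      have := mul_le_mul_of_nonneg_right hρ₃ hc
      linarith
    exact le_of_mul_le_mul_left h3 hn₂
  have hvk : v k ≤ (1 + ρ) * ((4 + 2 * ρ) * κ) := by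
    have h3 : m₁ * v k ≤ m₁ * ((1 + ρ) * ((4 + 2 * ρ) * κ)) := by
      have := mul_nonneg hn₂.le (hu0 k)
      have := mul_le_mul_of_nonneg_right hρ₂ hc
      linarith
    exact le_of_mul_le_mul_left h3 hm₁
  have := hu0 k
  have := hu0 0
  have := hv0 k
  have := hv0 0
  rw [abs_le, abs_le]
  exact ⟨⟨by linarith, by linarith⟩, ⟨by linarith, by linarith⟩⟩

end Oscillation

/-! ### Rates of the quadrant walk -/

section Quadrant

/-- The total rate of the down-jumps of coordinate `i`. -/
def downRate (mu nu : Fin 2 → ℝ) (i : Fin 2) (x : Fin 2 → ℕ) : ℝ :=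
  if x i = 0 then 0 else if x i.rev = 0 then mu i + nu i else mu i

/-- The states that can be reached from `x` by one jump. -/
def neighbours (x : Fin 2 → ℕ) : Finset (Fin 2 → ℕ) :=
  (Finset.univ.biUnion fun i : Fin 2 => {x + Pi.single i 1, x - Pi.single i 1}).erase x

theorem notMem_neighbours (x : Fin 2 → ℕ) : x ∉ neighbours x := Finset.notMem_erase _ _

theorem add_single_ne (x : Fin 2 → ℕ) (i : Fin 2) : x + Pi.single i 1 ≠ x := by
  intro h
  have := congrFun h i
  simp at this

theorem sub_single_add {x : Fin 2 → ℕ} {i : Fin 2} (h : x i ≠ 0) :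
    x - Pi.single i 1 + Pi.single i 1 = x := by
  funext j
  by_cases hj : j = i
  · subst hj; simp; omega
  · simp [hj]

theorem add_single_mem (x : Fin 2 → ℕ) (i : Fin 2) : x + Pi.single i 1 ∈ neighbours x :=
  Finset.mem_erase.2 ⟨add_single_ne x i, Finset.mem_biUnion.2 ⟨i, Finset.mem_univ _, by simp⟩⟩

theorem sub_single_mem {x : Fin 2 → ℕ} {i : Fin 2} (h : x i ≠ 0) :
    x - Pi.single i 1 ∈ neighbours x := by
  refine Finset.mem_erase.2 ⟨fun hc => ?_, Finset.mem_biUnion.2 ⟨i, Finset.mem_univ _, by simp⟩⟩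
  have h1 := sub_single_add h
  rw [hc] at h1
  exact add_single_ne x i h1

theorem eq_add_single_iff {x y : Fin 2 → ℕ} {i : Fin 2} (h : x i ≠ 0) :
    x = y + Pi.single i 1 ↔ y = x - Pi.single i 1 := by
  constructor
  · rintro rfl
    funext j
    simp
  · rintro rfl
    exact (sub_single_add h).symm

theorem ne_add_single {x y : Fin 2 → ℕ} {i : Fin 2} (h : x i = 0) : x ≠ y + Pi.single i 1 := by
  rintro rfl
  simp at h

variable (lam mu nu : Fin 2 → ℝ)

/-- A down-jump in direction `i` forces `x i > 0`, so interior and face are told apart by the other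
coordinate alone. -/
theorem quadrantIntensity_eq (x y : Fin 2 → ℕ) :
    quadrantIntensity lam mu nu x y = ∑ i : Fin 2, ((if y = x + Pi.single i 1 then lam i else 0) +
      (if x = y + Pi.single i 1 then downRate mu nu i x else 0)) := by
  refine Finset.sum_congr rfl fun i _ => ?_
  rw [add_assoc]
  congr 1
  by_cases hxy : x = y + Pi.single i 1
  · have hi : x i ≠ 0 := fun h => ne_add_single h hxy
    have hint : x ∈ latticeInterior ↔ x i.rev ≠ 0 := by
      change (∀ j, 0 < x j) ↔ _
      fin_cases i <;> simp [Fin.forall_fin_two, Fin.rev] at hi ⊢ <;> omega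
    have hface : x ∈ latticeFace i.rev ↔ x i.rev = 0 := by
      change (x i.rev = 0 ∧ 0 < x i.rev.rev) ↔ _
      rw [Fin.rev_rev]
      constructor
      · exact fun h => h.1
      · exact fun h => ⟨h, Nat.pos_of_ne_zero hi⟩
    rw [hint, hface, if_pos hxy, downRate, if_neg hi]
    by_cases h0 : x i.rev = 0
    · rw [if_neg fun h => h.1 h0, if_pos ⟨h0, hxy⟩, if_pos h0, zero_add]
    · rw [if_pos ⟨h0, hxy⟩, if_neg fun h => h0 h.1, if_neg h0, add_zero]
  · rw [if_neg fun h => hxy h.2, if_neg fun h => hxy h.2, if_neg hxy, zero_add]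

theorem quadrantIntensity_eq_zero {x y : Fin 2 → ℕ} (h : y ∉ neighbours x) (hyx : y ≠ x) :
    quadrantIntensity lam mu nu x y = 0 := by
  rw [quadrantIntensity_eq]
  refine Finset.sum_eq_zero fun i _ => ?_
  rw [if_neg, if_neg, add_zero]
  · intro hxy
    have hi : x i ≠ 0 := fun h => ne_add_single h hxy
    exact h ((eq_add_single_iff hi).1 hxy ▸ sub_single_mem hi)
  · rintro rfl
    exact h (add_single_mem x i)

theorem sum_quadrantIntensity_mul (x : Fin 2 → ℕ) (g : (Fin 2 → ℕ) → ℝ) :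
    ∑ y ∈ neighbours x, quadrantIntensity lam mu nu x y * g y =
      ∑ i : Fin 2, (lam i * g (x + Pi.single i 1) + downRate mu nu i x * g (x - Pi.single i 1)) := by
  simp only [quadrantIntensity_eq, Finset.sum_mul]
  rw [Finset.sum_comm]
  refine Finset.sum_congr rfl fun i _ => ?_
  simp only [add_mul, Finset.sum_add_distrib, ite_mul, zero_mul]
  congr 1
  · rw [Finset.sum_ite_eq' (neighbours x), if_pos (add_single_mem x i)]
  · by_cases hi : x i = 0
    · rw [downRate, if_pos hi, zero_mul]
      exact Finset.sum_eq_zero fun y _ => if_neg (ne_add_single hi)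
    · simp only [eq_add_single_iff hi]
      rw [Finset.sum_ite_eq' (neighbours x), if_pos (sub_single_mem hi)]

variable {lam mu nu}

theorem downRate_nonneg (hmu : ∀ i, 0 < mu i) (hnu : ∀ i, 0 < nu i) (i : Fin 2) (x : Fin 2 → ℕ) :
    0 ≤ downRate mu nu i x := by
  have := hmu i
  have := hnu i
  rw [downRate]; split_ifs <;> linarith

theorem downRate_le (hmu : ∀ i, 0 < mu i) (hnu : ∀ i, 0 < nu i) (i : Fin 2) (x : Fin 2 → ℕ) :
    downRate mu nu i x ≤ mu i + nu i := by
  have := hmu i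
  have := hnu i
  rw [downRate]; split_ifs <;> linarith

theorem quadrantIntensity_nonneg (hlam : ∀ i, 0 < lam i) (hmu : ∀ i, 0 < mu i)
    (hnu : ∀ i, 0 < nu i) (x y : Fin 2 → ℕ) : 0 ≤ quadrantIntensity lam mu nu x y := by
  rw [quadrantIntensity_eq]
  refine Finset.sum_nonneg fun i _ => add_nonneg ?_ ?_
  · split_ifs
    · exact (hlam i).le
    · exact le_rfl
  · split_ifs
    · exact downRate_nonneg hmu hnu i x
    · exact le_rfl

theorem sum_quadrantIntensity_le (hmu : ∀ i, 0 < mu i) (hnu : ∀ i, 0 < nu i)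
    (x : Fin 2 → ℕ) : ∑ y ∈ neighbours x, quadrantIntensity lam mu nu x y ≤
      ∑ i, (lam i + mu i + nu i) := by
  have h := sum_quadrantIntensity_mul lam mu nu x fun _ => 1
  simp only [mul_one] at h
  rw [h]
  exact Finset.sum_le_sum fun i _ => by linarith [downRate_le hmu hnu i x]

theorem rate_le_sum (hlam : ∀ i, 0 < lam i) (hmu : ∀ i, 0 < mu i) (hnu : ∀ i, 0 < nu i)
    (i : Fin 2) : lam i + mu i + nu i ≤ ∑ i, (lam i + mu i + nu i) :=
  Finset.single_le_sum (f := fun i => lam i + mu i + nu i)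
    (fun j _ => by have := hlam j; have := hmu j; have := hnu j; linarith) (Finset.mem_univ i)

/-- The exponential generator bound for a coordinate. -/
theorem sum_quadrantIntensity_mul_exp_le (hlam : ∀ i, 0 < lam i) (hmu : ∀ i, 0 < mu i)
    (hnu : ∀ i, 0 < nu i) (i : Fin 2) {θ : ℝ} (hθ : |θ| ≤ 1) (x : Fin 2 → ℕ) :
    ∑ y ∈ neighbours x, quadrantIntensity lam mu nu x y *
        (Real.exp (θ * ((y i : ℝ) - (x i : ℝ))) - 1) ≤
      θ * (lam i - downRate mu nu i x) + θ ^ 2 * ∑ i, (lam i + mu i + nu i) := by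
  rw [sum_quadrantIntensity_mul lam mu nu x fun y => Real.exp (θ * ((y i : ℝ) - (x i : ℝ))) - 1,
    Finset.sum_eq_single i]
  · have h1 : Real.exp (θ * (((x + Pi.single i 1 : Fin 2 → ℕ) i : ℝ) - (x i : ℝ))) - 1 ≤
        θ + θ ^ 2 := by
      have := le_of_abs_le (Real.abs_exp_sub_one_sub_id_le hθ)
      simp only [Pi.add_apply, Pi.single_eq_same]
      push_cast
      rw [add_sub_cancel_left, mul_one]
      linarith
    have h2 : downRate mu nu i x *
        (Real.exp (θ * (((x - Pi.single i 1 : Fin 2 → ℕ) i : ℝ) - (x i : ℝ))) - 1) ≤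
        downRate mu nu i x * (-θ + θ ^ 2) := by
      by_cases hi : x i = 0
      · simp [downRate, hi]
      · refine mul_le_mul_of_nonneg_left ?_ (downRate_nonneg hmu hnu i x)
        have := le_of_abs_le (Real.abs_exp_sub_one_sub_id_le (x := -θ) (by rwa [abs_neg]))
        simp only [Pi.sub_apply, Pi.single_eq_same]
        rw [Nat.cast_sub (Nat.pos_of_ne_zero hi), Nat.cast_one, sub_sub_cancel_left, mul_neg_one]
        rw [neg_sq] at this
        linarith
    have h3 := mul_le_mul_of_nonneg_left h1 (hlam i).le
    have h4 := downRate_le hmu hnu i x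
    have h5 := rate_le_sum hlam hmu hnu i
    have h6 : θ ^ 2 * (lam i + downRate mu nu i x) ≤ θ ^ 2 * ∑ i, (lam i + mu i + nu i) :=
      mul_le_mul_of_nonneg_left (by linarith) (sq_nonneg θ)
    linarith
  · intro j _ hj
    simp [Pi.single_eq_of_ne (Ne.symm hj)]
  · exact fun h => absurd (Finset.mem_univ i) h

/-- The skeleton of a quadrant walk moves by at most a constant times its noise. -/
theorem quadrant_abs_sub_le (hmu : ∀ i, 0 < mu i) (hnu : ∀ i, 0 < nu i)
    (hdir : mu 0 * mu 1 ≤ nu 0 * nu 1) {ρ κ₀ κ D h δ : ℝ} {K : ℕ}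
    (hρ₁ : ∀ i, nu i ≤ ρ * mu i.rev) (hρ₂ : ∀ i, mu i ≤ ρ * nu i.rev)
    (hD : ∀ i, |lam i - mu i| ≤ D) (hh : 0 ≤ h) (hδ : K * h ≤ δ) (hκ : κ₀ + D * δ ≤ κ)
    (hhκ : ∀ i, h * mu i ≤ κ) (s : ℕ → Fin 2 → ℕ)
    (hs : ∀ i, ∀ k ≤ K, |noise (fun x : Fin 2 → ℕ => (x i : ℝ))
      (fun x => lam i - downRate mu nu i x) h s k| ≤ κ₀) :
    ∀ k ≤ K, ∀ i, |(s k i : ℝ) - s 0 i| ≤ (1 + ρ) * (4 + 2 * ρ) * κ := by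
  -- The residual drift `lam i - mu i` counts as noise. What remains of the drift is `mu i` on the
  -- coordinate's own zero set and `-nu i` where only the other one vanishes.
  let N : Fin 2 → ℕ → ℝ := fun i k => noise (fun x : Fin 2 → ℕ => (x i : ℝ))
      (fun x => lam i - downRate mu nu i x) h s k + (lam i - mu i) * (k * h)
  have hN0 : ∀ i, N i 0 = 0 := fun i => by simp [N, noise_zero]
  have hD0 : 0 ≤ D := (abs_nonneg _).trans (hD 0)
  have hN : ∀ i, ∀ k ≤ K, |N i k| ≤ κ := by
    intro i k hk
    have hkh : (0 : ℝ) ≤ k * h := by positivity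
    have h1 : |(lam i - mu i) * (k * h)| ≤ D * δ := by
      rw [abs_mul, abs_of_nonneg hkh]
      refine mul_le_mul (hD i) ?_ hkh hD0
      refine le_trans ?_ hδ
      exact mul_le_mul_of_nonneg_right (by exact_mod_cast hk) hh
    exact (abs_add_le _ _).trans ((add_le_add (hs i k hk) h1).trans hκ)
  have hrec : ∀ i k, (s (k + 1) i : ℝ) = s k i + (N i (k + 1) - N i k) +
      h * (if (s k i : ℝ) = 0 then mu i else if (s k i.rev : ℝ) = 0 then -nu i else 0) := by
    intro i k
    simp only [N, noise_succ, downRate, Nat.cast_eq_zero]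
    push_cast
    split_ifs <;> ring
  intro k hk
  have h := abs_sub_le_of_noise_le (u := fun k => (s k 0 : ℝ)) (v := fun k => (s k 1 : ℝ))
    (A := N 0) (B := N 1) (ρ := ρ) hh (hmu 0) (hmu 1) (hnu 0) (hnu 1) hdir
    (fun _ => Nat.cast_nonneg _) (fun _ => Nat.cast_nonneg _) (hN0 0) (hN0 1) (hN 0) (hN 1)
    (hrec 0) (hrec 1) (hhκ 0) (hhκ 1) (hρ₁ 0) (hρ₁ 1) (hρ₂ 0) k hk
  rw [Fin.forall_fin_two]
  exact h

end Quadrant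

/-! ### From time grids to continuous time -/

/-- Continuity from below along `⋂ k ≥ n, B k`. No measurability is needed, which suits events
quantified over all real times. -/
theorem measure_le_of_eventually_mem {Ω : Type*} [MeasurableSpace Ω] (μ : Measure Ω) {s : Set Ω}
    {B : ℕ → Set Ω} {q : ℕ → ℝ≥0∞} {c : ℝ≥0∞} (hs : ∀ ω ∈ s, ∀ᶠ k in atTop, ω ∈ B k)
    (hB : ∀ᶠ k in atTop, μ (B k) ≤ q k) (hq : Tendsto q atTop (𝓝 c)) : μ s ≤ c := by
  have hsub : s ⊆ ⋃ n, ⋂ k ≥ n, B k := fun ω hω => by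
    obtain ⟨n, hn⟩ := eventually_atTop.1 (hs ω hω)
    exact mem_iUnion.2 ⟨n, mem_iInter₂.2 hn⟩
  have hmono : Monotone fun n => ⋂ k ≥ n, B k := fun m n hmn ω hω =>
    mem_iInter₂.2 fun k hk => mem_iInter₂.1 hω k (hmn.trans hk)
  refine (measure_mono hsub).trans ?_
  rw [hmono.measure_iUnion]
  refine iSup_le fun n => ge_of_tendsto hq ?_
  filter_upwards [hB, eventually_ge_atTop n] with k hk hnk
  exact (measure_mono (biInter_subset_of_mem hnk)).trans hk

section Quadrant

variable {Ω : Type*} [MeasurableSpace Ω] {μ : ProbabilityMeasure Ω} {lam mu nu : Fin 2 → ℝ}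
  {x₀ : Fin 2 → ℕ} {X : Ω → SkorokhodSpace (Fin 2 → ℕ)}

/-- Tail bound for the noise of one coordinate of the skeleton. -/
theorem IsMarkovJumpProcess.measure_noise_ge_le
    (hX : IsMarkovJumpProcess μ (quadrantIntensity lam mu nu) x₀ X)
    (hlam : ∀ i, 0 < lam i) (hmu : ∀ i, 0 < mu i) (hnu : ∀ i, 0 < nu i)
    {θ M Λ : ℝ} (hθ0 : 0 < θ) (hθ1 : θ ≤ 1) (hM : 0 < M) (hΛ : ∑ i, (lam i + mu i + nu i) = Λ)
    {h : ℝ≥0} (hh : h * Λ ≤ 1 / 2) (a : ℝ≥0) (K : ℕ) (i : Fin 2) :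
    (μ : Measure Ω).real {ω | ∃ k ≤ K, Real.log M / θ + θ * Λ * (K * h) <
      |noise (fun x : Fin 2 → ℕ => (x i : ℝ)) (fun x => lam i - downRate mu nu i x) h
        (fun j => X ω (a + j * h)) k|} ≤ 2 / M + 16 * K * (h * Λ) ^ 2 := by
  have hrate := rate_le_sum hlam hmu hnu i
  rw [hΛ] at hrate
  have hΛ0 : 0 ≤ Λ := by have := hlam i; have := hmu i; have := hnu i; linarith
  have hdrift : ∀ x, |lam i - downRate mu nu i x| ≤ Λ := fun x => by
    have h1 := downRate_le hmu hnu i x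
    have h2 := downRate_nonneg hmu hnu i x
    have := hlam i; have := hmu i; have := hnu i
    rw [abs_le]; constructor <;> linarith
  -- Both signs of the exponent are needed to control the absolute value of the noise.
  have key : ∀ σ : ℝ, |σ| = θ → (μ : Measure Ω).real {ω | ∃ k ≤ K,
      M ≤ Real.exp (σ * noise (fun x : Fin 2 → ℕ => (x i : ℝ))
        (fun x => lam i - downRate mu nu i x) h (fun j => X ω (a + j * h)) k -
        θ ^ 2 * Λ * (k * h))} ≤ 1 / M + 8 * K * (h * Λ) ^ 2 := by
    intro σ hσ
    refine hX.measure_exp_noise_ge_le (S := neighbours) notMem_neighbours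
      (fun x y hyx hy => quadrantIntensity_eq_zero lam mu nu hy hyx)
      (fun x y _ => quadrantIntensity_nonneg hlam hmu hnu x y)
      (fun x => hΛ ▸ sum_quadrantIntensity_le hmu hnu x) (fun x => ?_) (fun x => ?_) hM a K
    · have := sum_quadrantIntensity_mul_exp_le hlam hmu hnu i (θ := σ) (hσ ▸ hθ1) x
      rwa [hΛ, ← sq_abs σ, hσ] at this
    · have h1 : -(σ * (lam i - downRate mu nu i x)) ≤ Λ := by
        refine (neg_le_abs _).trans ?_
        rw [abs_mul, hσ]
        exact (mul_le_of_le_one_left (abs_nonneg _) hθ1).trans (hdrift x)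
      have h2 : 0 ≤ θ ^ 2 * Λ := by positivity
      have h3 := mul_le_mul_of_nonneg_left h1 h.coe_nonneg
      have h4 := mul_nonneg h.coe_nonneg h2
      linarith
  have hsub : {ω | ∃ k ≤ K, Real.log M / θ + θ * Λ * (K * h) <
      |noise (fun x : Fin 2 → ℕ => (x i : ℝ)) (fun x => lam i - downRate mu nu i x) h
        (fun j => X ω (a + j * h)) k|} ⊆
      {ω | ∃ k ≤ K, M ≤ Real.exp (θ * noise (fun x : Fin 2 → ℕ => (x i : ℝ))
        (fun x => lam i - downRate mu nu i x) h (fun j => X ω (a + j * h)) k -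
        θ ^ 2 * Λ * (k * h))} ∪
      {ω | ∃ k ≤ K, M ≤ Real.exp (-θ * noise (fun x : Fin 2 → ℕ => (x i : ℝ))
        (fun x => lam i - downRate mu nu i x) h (fun j => X ω (a + j * h)) k -
        θ ^ 2 * Λ * (k * h))} := by
    rintro ω ⟨k, hk, hlt⟩
    set w := noise (fun x : Fin 2 → ℕ => (x i : ℝ)) (fun x => lam i - downRate mu nu i x) h
        (fun j => X ω (a + j * h)) k with hw
    have h1 : Real.log M + θ ^ 2 * Λ * (k * h) ≤ θ * |w| := by
      have h2 := mul_lt_mul_of_pos_left hlt hθ0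
      rw [mul_add, mul_div_cancel₀ _ hθ0.ne'] at h2
      have h3 : θ ^ 2 * Λ * (k * h) ≤ θ ^ 2 * Λ * (K * h) :=
        mul_le_mul_of_nonneg_left (mul_le_mul_of_nonneg_right (by exact_mod_cast hk) h.coe_nonneg)
          (by positivity)
      linarith
    rcases abs_cases w with ⟨hw1, -⟩ | ⟨hw1, -⟩
    · refine Or.inl ⟨k, hk, ?_⟩
      rw [← Real.log_le_iff_le_exp hM, ← hw]
      rw [hw1] at h1; linarith
    · refine Or.inr ⟨k, hk, ?_⟩
      rw [← Real.log_le_iff_le_exp hM, ← hw]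
      rw [hw1] at h1; linarith
  refine (measureReal_mono hsub).trans ((measureReal_union_le _ _).trans ?_)
  have h1 := key θ (abs_of_pos hθ0)
  have h2 := key (-θ) (by rw [abs_neg, abs_of_pos hθ0])
  calc _ ≤ (1 / M + 8 * K * (h * Λ) ^ 2) + (1 / M + 8 * K * (h * Λ) ^ 2) := add_le_add h1 h2
    _ = _ := by ring

/-- Tail bound for the oscillation of a quadrant walk over a time interval. -/
theorem IsMarkovJumpProcess.measure_exists_lt_abs_sub_le
    (hX : IsMarkovJumpProcess μ (quadrantIntensity lam mu nu) x₀ X)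
    (hlam : ∀ i, 0 < lam i) (hmu : ∀ i, 0 < mu i) (hnu : ∀ i, 0 < nu i)
    (hdir : mu 0 * mu 1 ≤ nu 0 * nu 1) {ρ θ M Λ D κ : ℝ}
    (hρ₁ : ∀ i, nu i ≤ ρ * mu i.rev) (hρ₂ : ∀ i, mu i ≤ ρ * nu i.rev)
    (hD : ∀ i, |lam i - mu i| ≤ D)
    (hθ0 : 0 < θ) (hθ1 : θ ≤ 1) (hM : 1 < M) (hΛ : ∑ i, (lam i + mu i + nu i) = Λ)
    {δ : ℝ≥0} (hκ : Real.log M / θ + θ * Λ * δ + D * δ ≤ κ) (a : ℝ≥0) :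
    (μ : Measure Ω) {ω | ∃ s, a ≤ s ∧ s ≤ a + δ ∧ ∃ i,
      (1 + ρ) * (4 + 2 * ρ) * κ < |(X ω s i : ℝ) - X ω a i|} ≤ ENNReal.ofReal (4 / M) := by
  have hM0 : 0 < M := one_pos.trans hM
  have hΛ0 : 0 ≤ Λ := hΛ ▸ Finset.sum_nonneg fun i _ => by
    have := hlam i; have := hmu i; have := hnu i; linarith
  have hD0 : 0 ≤ D := (abs_nonneg _).trans (hD 0)
  have hκ0 : 0 < κ := by
    have h1 : 0 < Real.log M / θ := div_pos (Real.log_pos hM) hθ0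
    have h2 : 0 ≤ θ * Λ * δ := by positivity
    have h3 : 0 ≤ D * δ := by positivity
    linarith
  let h : ℕ → ℝ≥0 := fun K => δ / ((K : ℝ≥0) + 1)
  have hh0 : Tendsto h atTop (𝓝 0) := by
    have := (tendsto_one_div_add_atTop_nhds_zero_nat (𝕜 := ℝ≥0)).const_mul δ
    simpa only [mul_one_div, mul_zero] using this
  have hh0' : Tendsto (fun K => (h K : ℝ)) atTop (𝓝 0) := by
    simpa using NNReal.tendsto_coe.2 hh0
  have hKh : ∀ K : ℕ, ((K + 1 : ℕ) : ℝ≥0) * h K = δ := fun K => by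
    simp only [h]
    push_cast
    rw [mul_div_cancel₀]
    positivity
  have hKh' : ∀ K : ℕ, ((K + 1 : ℕ) : ℝ) * h K = δ := fun K => by exact_mod_cast hKh K
  refine measure_le_of_eventually_mem (μ : Measure Ω)
    (B := fun K => {ω | ∃ k ≤ K + 1, ∃ i,
      (1 + ρ) * (4 + 2 * ρ) * κ < |(X ω (a + k * h K) i : ℝ) - X ω a i|})
    (q := fun K => ENNReal.ofReal (4 / M + 32 * δ * Λ ^ 2 * h K)) ?_ ?_ ?_
  · rintro ω ⟨s, has, hsδ, i, hi⟩
    -- The first grid point at or after `s`: for a fine grid it lies in the interval to the right of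
    -- `s` where the path is constant.
    let k : ℕ → ℕ := fun K => ⌈(s - a) / h K⌉₊
    rcases eq_or_ne δ 0 with hδ0 | hδ0
    · have hsa : s = a := le_antisymm (by rw [hδ0, add_zero] at hsδ; exact hsδ) has
      refine Eventually.of_forall fun K => ⟨0, Nat.zero_le _, i, ?_⟩
      rw [hsa] at hi
      simpa using hi
    have hhpos : ∀ K, 0 < h K := fun K => div_pos (pos_iff_ne_zero.2 hδ0) (by positivity)
    obtain ⟨b, hb, hconst⟩ := ((X ω).2).exists_const_right s
    have hev : ∀ᶠ K in atTop, h K < b := hh0.eventually_lt_const hb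
    filter_upwards [hev] with K hK
    have hge : s ≤ a + k K * h K := by
      have h1 := Nat.le_ceil ((s - a) / h K)
      rw [div_le_iff₀ (hhpos K), tsub_le_iff_left] at h1
      exact h1
    have hlt : a + k K * h K < s + b := by
      have h1 := Nat.ceil_lt_add_one (a := (s - a) / h K) zero_le
      have h2 := mul_lt_mul_of_pos_right h1 (hhpos K)
      rw [add_mul, one_mul, div_mul_cancel₀ _ (hhpos K).ne'] at h2
      calc a + k K * h K < a + ((s - a) + h K) := by gcongr
        _ = s + h K := by rw [← add_assoc, add_tsub_cancel_of_le has]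
        _ < s + b := by gcongr
    refine ⟨k K, Nat.ceil_le.2 ?_, i, ?_⟩
    · rw [div_le_iff₀ (hhpos K), hKh, tsub_le_iff_left]
      exact hsδ
    · have h1 := hconst (a + k K * h K - s) (by rw [tsub_lt_iff_left hge]; exact hlt)
      rw [add_tsub_cancel_of_le hge] at h1
      rw [h1]
      exact hi
  · have hev1 : ∀ᶠ K in atTop, (h K : ℝ) * Λ ≤ 1 / 2 := by
      have := hh0'.mul_const Λ
      rw [zero_mul] at this
      exact this.eventually_le_const (by norm_num)
    have hev2 : ∀ᶠ K in atTop, ∀ i, (h K : ℝ) * mu i ≤ κ := by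
      rw [eventually_all]
      intro i
      have := hh0'.mul_const (mu i)
      rw [zero_mul] at this
      exact this.eventually_le_const hκ0
    filter_upwards [hev1, hev2] with K hK1 hK2
    have hn := fun i => hX.measure_noise_ge_le hlam hmu hnu hθ0 hθ1 hM0 hΛ hK1 a (K + 1) i
    have hsub : {ω | ∃ k ≤ K + 1, ∃ i,
        (1 + ρ) * (4 + 2 * ρ) * κ < |(X ω (a + k * h K) i : ℝ) - X ω a i|} ⊆
        ⋃ i : Fin 2, {ω | ∃ k ≤ K + 1, Real.log M / θ + θ * Λ * ((K + 1 : ℕ) * h K) <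
          |noise (fun x : Fin 2 → ℕ => (x i : ℝ)) (fun x => lam i - downRate mu nu i x) (h K)
            (fun j => X ω (a + j * h K)) k|} := by
      rintro ω ⟨k, hk, i, hi⟩
      by_contra hcon
      simp only [mem_iUnion, mem_ofPred_eq, not_exists, not_and, not_lt] at hcon
      have h1 := quadrant_abs_sub_le (lam := lam) (κ := κ) hmu hnu hdir hρ₁ hρ₂ hD
        (h K).coe_nonneg (hKh' K).le (by rw [hKh' K]; exact hκ) hK2 (fun j => X ω (a + j * h K)) hcon
        k hk i
      simp only [Nat.cast_zero, zero_mul, add_zero] at h1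
      exact absurd hi (not_lt.2 h1)
    refine (measure_mono hsub).trans ((measure_iUnion_le _).trans ?_)
    rw [tsum_fintype, Fin.sum_univ_two]
    have hreal : ∀ i, (μ : Measure Ω) {ω | ∃ k ≤ K + 1,
        Real.log M / θ + θ * Λ * ((K + 1 : ℕ) * h K) <
          |noise (fun x : Fin 2 → ℕ => (x i : ℝ)) (fun x => lam i - downRate mu nu i x) (h K)
            (fun j => X ω (a + j * h K)) k|} ≤
        ENNReal.ofReal (2 / M + 16 * (K + 1 : ℕ) * (h K * Λ) ^ 2) := fun i => by
      rw [← ofReal_measureReal]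
      exact ENNReal.ofReal_le_ofReal (hn i)
    refine (add_le_add (hreal 0) (hreal 1)).trans (le_of_eq ?_)
    rw [← ENNReal.ofReal_add (by positivity) (by positivity)]
    congr 1
    -- Since `(K + 1) * h K = δ`, the summed second order errors are proportional to `h K` and
    -- vanish in the limit.
    rw [← hKh' K]
    ring
  · refine ENNReal.tendsto_ofReal ?_
    have := (hh0'.const_mul (32 * δ * Λ ^ 2)).const_add (4 / M)
    simpa using this

theorem dist_rescale_le (n : ℕ+) {x y : Fin 2 → ℕ} {c : ℝ} (h : ∀ i, |(x i : ℝ) - y i| ≤ c) :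
    dist (rescale n x) (rescale n y) ≤ 2 * c / √((n : ℕ) : ℝ) := by
  have hn : 0 < √((n : ℕ) : ℝ) := Real.sqrt_pos.2 (by exact_mod_cast n.pos)
  have hc : 0 ≤ c := (abs_nonneg _).trans (h 0)
  rw [Subtype.dist_eq, EuclideanSpace.dist_eq, Fin.sum_univ_two]
  have hi : ∀ i, dist ((rescale n x : EuclideanSpace ℝ (Fin 2)) i)
      ((rescale n y : EuclideanSpace ℝ (Fin 2)) i) ≤ c / √((n : ℕ) : ℝ) := by
    intro i
    rw [Real.dist_eq]
    change |(x i : ℝ) / √((n : ℕ) : ℝ) - (y i : ℝ) / √((n : ℕ) : ℝ)| ≤ _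
    rw [← sub_div, abs_div, abs_of_pos hn]
    exact div_le_div_of_nonneg_right (h i) hn.le
  have h0 := pow_le_pow_left₀ dist_nonneg (hi 0) 2
  have h1 := pow_le_pow_left₀ dist_nonneg (hi 1) 2
  refine Real.sqrt_le_iff.2 ⟨by positivity, ?_⟩
  have h2 : 2 * c / √((n : ℕ) : ℝ) = 2 * (c / √((n : ℕ) : ℝ)) := by ring
  rw [h2, mul_pow]
  have : 0 ≤ (c / √((n : ℕ) : ℝ)) ^ 2 := by positivity
  linarith

/-- Oscillation over blocks controls the modulus of continuity. -/
theorem not_hasOsc_of_blocks {f : ℝ≥0 → Fin 2 → ℕ} {T : ℕ} {δ : ℝ≥0} (hδ : 0 < δ) {c : ℝ} {N : ℕ}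
    (hN : T ≤ N * δ)
    (hf : ∀ j ≤ N, ∀ s, j * δ ≤ s → s ≤ j * δ + δ → ∀ i, |(f s i : ℝ) - f (j * δ) i| ≤ c)
    (n : ℕ+) {ε : ℝ} (hε : 6 * c / √((n : ℕ) : ℝ) ≤ ε) :
    ¬ HasOsc (T : ℝ≥0) δ ε fun t => rescale n (f t) := by
  have hc : 0 ≤ c := (abs_nonneg _).trans (hf 0 (Nat.zero_le _) 0 (by simp) (by simp) 0)
  -- Times at distance at most `δ` lie in the same or in adjacent blocks; comparison through the
  -- block starts takes at most three steps of size `c`.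
  have key : ∀ s t : ℝ≥0, s ≤ t → t ≤ T → dist s t ≤ δ → ∀ i, |(f s i : ℝ) - f t i| ≤ 3 * c := by
    intro s t hst htT hd i
    set j := ⌊s / δ⌋₊ with hj
    have hj1 : j * δ ≤ s := by
      rw [← le_div_iff₀ hδ]; exact Nat.floor_le zero_le
    have hj2 : s < j * δ + δ := by
      have := Nat.lt_floor_add_one (s / δ)
      rw [div_lt_iff₀ hδ, add_mul, one_mul] at this
      exact this
    have hjN : j ≤ N := Nat.floor_le_of_le (by rw [div_le_iff₀ hδ]; exact (hst.trans htT).trans hN)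
    have h1 := abs_le.1 (hf j hjN s hj1 hj2.le i)
    rcases le_total t (j * δ + δ) with h | h
    · have h2 := abs_le.1 (hf j hjN t (hj1.trans hst) h i)
      rw [abs_le]; constructor <;> linarith
    · have hj' : ((j + 1 : ℕ) : ℝ≥0) * δ = j * δ + δ := by push_cast; ring
      have hjN' : j + 1 ≤ N := by
        have : ((j + 1 : ℕ) : ℝ≥0) * δ ≤ N * δ := by rw [hj']; exact h.trans (htT.trans hN)
        exact_mod_cast le_of_mul_le_mul_right this hδ
      have htd : t ≤ j * δ + δ + δ := by
        have h3 : t ≤ s + δ := by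
          rw [dist_comm, NNReal.dist_eq, abs_le] at hd
          rw [← NNReal.coe_le_coe]; push_cast; linarith
        exact h3.trans (by gcongr)
      have h2 := abs_le.1 (hf j hjN (j * δ + δ) le_self_add le_rfl i)
      have h3 := abs_le.1 (hf (j + 1) hjN' t (by rw [hj']; exact h) (by rw [hj']; exact htd) i)
      rw [hj'] at h3
      rw [abs_le]; constructor <;> linarith
  rintro ⟨s, hs, t, ht, hd, hlt⟩
  refine absurd hlt (not_lt.2 (le_trans ?_ hε))
  have h3 : 2 * (3 * c) / √((n : ℕ) : ℝ) = 6 * c / √((n : ℕ) : ℝ) := by ring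
  rw [← h3]
  rcases le_total s t with h | h
  · exact dist_rescale_le n (key s t h ht hd)
  · refine dist_rescale_le n fun i => ?_
    rw [abs_sub_comm]
    exact key t s h hs (by rwa [dist_comm]) i

end Quadrant

/-! ### Diffusive scaling and the conclusion -/

instance : ProperSpace Quadrant where
  isCompact_closedBall x r := by
    have hcl : IsClosed {x : EuclideanSpace ℝ (Fin 2) | ∀ i, 0 ≤ x i} := by
      rw [ofPred_forall]
      exact isClosed_iInter fun i => isClosed_le continuous_const (by fun_prop)
    exact hcl.isClosedEmbedding_subtypeVal.isCompact_preimage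
      (isCompact_closedBall (x : EuclideanSpace ℝ (Fin 2)) r)

theorem tendsto_sqrt_pnat : Tendsto (fun n : ℕ+ => √((n : ℕ) : ℝ)) atTop atTop :=
  Real.tendsto_sqrt_atTop.comp (tendsto_natCast_atTop_atTop.comp tendsto_PNat_val_atTop_atTop)

theorem sqrt_pnat_pos (n : ℕ+) : 0 < √((n : ℕ) : ℝ) := Real.sqrt_pos.2 (by exact_mod_cast n.pos)

/-- Second order scaling implies first order scaling. -/
theorem tendsto_div_of_tendsto_sub_div_sqrt {f : ℕ+ → ℝ} {a b : ℝ}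
    (h : Tendsto (fun n : ℕ+ => (f n - ((n : ℕ) : ℝ) * a) / √((n : ℕ) : ℝ)) atTop (𝓝 b)) :
    Tendsto (fun n : ℕ+ => f n / ((n : ℕ) : ℝ)) atTop (𝓝 a) := by
  have h1 := (h.div_atTop tendsto_sqrt_pnat).add_const a
  rw [zero_add] at h1
  refine h1.congr fun n => ?_
  have hn : ((n : ℕ) : ℝ) ≠ 0 := by exact_mod_cast n.pos.ne'
  rw [div_div, Real.mul_self_sqrt (Nat.cast_nonneg _)]
  field_simp
  ring

theorem eventually_le_of_tendsto_div {f g : ℕ+ → ℝ} {a b : ℝ}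
    (hf : Tendsto (fun n : ℕ+ => f n / ((n : ℕ) : ℝ)) atTop (𝓝 a))
    (hg : Tendsto (fun n : ℕ+ => g n / ((n : ℕ) : ℝ)) atTop (𝓝 b)) (hab : a < b) :
    ∀ᶠ n in atTop, f n ≤ g n := by
  filter_upwards [hf.eventually_lt hg hab] with n hn
  have hn0 : (0 : ℝ) < ((n : ℕ) : ℝ) := by exact_mod_cast n.pos
  exact ((div_lt_div_iff_of_pos_right hn0).1 hn).le

/-- Supplies one ball containing all rescaled initial states, not only those for large indices. -/
theorem isBounded_range_pnat {E : Type*} [PseudoMetricSpace E] {u : ℕ+ → E} {c : E}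
    (h : Tendsto u atTop (𝓝 c)) : Bornology.IsBounded (range u) := by
  have h1 : Tendsto Nat.succPNat atTop atTop :=
    tendsto_atTop_atTop.2 fun b => ⟨b, fun a ha => by
      rw [← PNat.coe_le_coe, Nat.succPNat_coe]; omega⟩
  refine (Metric.isBounded_range_of_tendsto _ (h.comp h1)).subset ?_
  rintro _ ⟨n, rfl⟩
  exact ⟨n.natPred, by simp⟩

/-- The oscillation of a quadrant walk on `[0, T]`, for rates of order `n`. -/
theorem IsMarkovJumpProcess.measure_hasOsc_le {Ω : Type*} [MeasurableSpace Ω]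
    {μ : ProbabilityMeasure Ω} {lam mu nu : Fin 2 → ℝ} {x₀ : Fin 2 → ℕ}
    {X : Ω → SkorokhodSpace (Fin 2 → ℕ)}
    (hX : IsMarkovJumpProcess μ (quadrantIntensity lam mu nu) x₀ X)
    (hlam : ∀ i, 0 < lam i) (hmu : ∀ i, 0 < mu i) (hnu : ∀ i, 0 < nu i)
    (hdir : mu 0 * mu 1 ≤ nu 0 * nu 1) {ρ C₀ C₁ d ε : ℝ} (n : ℕ+)
    (hρ₁ : ∀ i, nu i ≤ ρ * mu i.rev) (hρ₂ : ∀ i, mu i ≤ ρ * nu i.rev)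
    (hΛ : ∑ i, (lam i + mu i + nu i) ≤ C₀ * ((n : ℕ) : ℝ))
    (hD : ∀ i, |lam i - mu i| ≤ C₁ * √((n : ℕ) : ℝ))
    (hd0 : 0 < d) (hd1 : d < 1) (hnd : 1 ≤ √((n : ℕ) : ℝ) * d) (T : ℕ)
    (hε : 6 * ((1 + ρ) * (4 + 2 * ρ)) * (-4 * (d * Real.log d) + C₀ * d + C₁ * d ^ 2) ≤ ε) :
    (μ : Measure Ω) {ω | HasOsc (T : ℝ≥0) (d ^ 2) ε fun t => rescale n (X ω t)} ≤
      ENNReal.ofReal (4 * T * d ^ 2 + 8 * d ^ 4) := by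
  set w := √((n : ℕ) : ℝ) with hw
  have hw0 : 0 < w := sqrt_pnat_pos n
  have hww : w * w = ((n : ℕ) : ℝ) := Real.mul_self_sqrt (Nat.cast_nonneg _)
  let δ : ℝ≥0 := ⟨d ^ 2, by positivity⟩
  have hδ0 : 0 < δ := by
    rw [← NNReal.coe_lt_coe]; change (0 : ℝ) < d ^ 2; positivity
  set κ := w * (-4 * (d * Real.log d) + C₀ * d + C₁ * d ^ 2) with hκ
  set c := (1 + ρ) * (4 + 2 * ρ) * κ with hc
  have hblock : ∀ a : ℝ≥0, (μ : Measure Ω) {ω | ∃ s, a ≤ s ∧ s ≤ a + δ ∧ ∃ i,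
      c < |(X ω s i : ℝ) - X ω a i|} ≤ ENNReal.ofReal (4 * d ^ 4) := by
    intro a
    have hM : 1 < 1 / d ^ 4 := by
      rw [one_lt_div (by positivity)]
      exact pow_lt_one₀ hd0.le hd1 (by norm_num)
    -- The exponent `1 / (w * d)` makes `log M / θ` of order `w d |log d|` and `θ Λ δ` of order `w
    -- d`. The level `d⁻⁴` gives failure probability `4 d⁴`, small against the `d⁻²` blocks, at only
    -- logarithmic cost.
    have h := hX.measure_exists_lt_abs_sub_le hlam hmu hnu hdir (ρ := ρ) (θ := 1 / (w * d))
      (M := 1 / d ^ 4) (D := C₁ * w) (κ := κ) (δ := δ) hρ₁ hρ₂ hD (by positivity)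
      (by rw [div_le_one (by positivity)]; exact hnd) hM rfl ?_ a
    · rwa [div_div_eq_mul_div, div_one] at h
    · have h1 : Real.log (1 / d ^ 4) = -4 * Real.log d := by
        rw [one_div, Real.log_inv, Real.log_pow]; push_cast; ring
      have h2 : 1 / (w * d) * (∑ i, (lam i + mu i + nu i)) * δ ≤ w * (C₀ * d) := by
        have h3 : 1 / (w * d) * (∑ i, (lam i + mu i + nu i)) * δ ≤
            1 / (w * d) * (C₀ * (w * w)) * δ := by
          rw [hww]; gcongr
        refine h3.trans (le_of_eq ?_)
        change 1 / (w * d) * (C₀ * (w * w)) * d ^ 2 = _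
        field_simp
      rw [h1]
      have h4 : -4 * Real.log d / (1 / (w * d)) = w * (-4 * (d * Real.log d)) := by
        field_simp
      have h5 : C₁ * w * (δ : ℝ) = w * (C₁ * d ^ 2) := by
        change C₁ * w * d ^ 2 = _
        ring
      rw [h4, h5, hκ]
      linarith
  set N := ⌈(T : ℝ≥0) / δ⌉₊ with hN
  have hTN : (T : ℝ≥0) ≤ N * δ := by
    rw [← div_le_iff₀ hδ0]; exact Nat.le_ceil _
  have hsub : {ω | HasOsc (T : ℝ≥0) (d ^ 2) ε fun t => rescale n (X ω t)} ⊆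
      ⋃ j ∈ Finset.range (N + 1), {ω | ∃ s, j * δ ≤ s ∧ s ≤ j * δ + δ ∧ ∃ i,
        c < |(X ω s i : ℝ) - X ω (j * δ) i|} := by
    intro ω hω
    by_contra hcon
    simp only [mem_iUnion, Finset.mem_range, mem_ofPred_eq, not_exists, not_and, not_lt] at hcon
    refine not_hasOsc_of_blocks (f := X ω) hδ0 hTN (c := c)
      (fun j hj s h1 h2 i => hcon j (by omega) s h1 h2 i) n ?_ hω
    refine le_trans (le_of_eq ?_) hε
    rw [hc, hκ, ← hw]
    field_simp
  refine (measure_mono hsub).trans ((measure_biUnion_finset_le _ _).trans ?_)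
  refine (Finset.sum_le_sum fun (j : ℕ) _ => hblock ((j : ℝ≥0) * δ)).trans ?_
  rw [Finset.sum_const, Finset.card_range, nsmul_eq_mul, ← ENNReal.ofReal_natCast,
    ← ENNReal.ofReal_mul (Nat.cast_nonneg _)]
  refine ENNReal.ofReal_le_ofReal ?_
  -- The `N + 1 ≤ T / d² + 2` blocks, each failing with probability at most `4 d⁴`, give `4 T d² + 8
  -- d⁴`.
  have hNle : (N : ℝ) ≤ T / d ^ 2 + 1 := by
    have := (Nat.ceil_lt_add_one (a := (T : ℝ≥0) / δ) zero_le).le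
    have h2 : ((N : ℝ≥0) : ℝ) ≤ ((T / δ + 1 : ℝ≥0) : ℝ) := NNReal.coe_le_coe.2 this
    push_cast at h2
    exact h2
  have h3 : (T : ℝ) / d ^ 2 * d ^ 4 = T * d ^ 2 := by field_simp
  have h4 := mul_le_mul_of_nonneg_right hNle (show 0 ≤ d ^ 4 by positivity)
  push_cast
  linarith

theorem proposition3p1 {Ω : Type*} [MeasurableSpace Ω] (μ : ProbabilityMeasure Ω)
    -- prelimit rates and initial states, `n = 1, 2, …`
    (lamN muN nuN : ℕ+ → Fin 2 → ℝ) (xN : ℕ+ → Fin 2 → ℕ)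
    -- first and second order limits of the rates, and limit of the rescaled initial states
    (lam mu nu lamHat muHat nuHat : Fin 2 → ℝ) (xHat : Quadrant)
    (hlamN : ∀ n i, 0 < lamN n i) (hmuN : ∀ n i, 0 < muN n i) (hnuN : ∀ n i, 0 < nuN n i)
    (hlam : ∀ i, 0 < lam i) (hmu : ∀ i, 0 < mu i) (hnu : ∀ i, 0 < nu i)
    (hlamHat : ∀ i, Tendsto
      (fun n : ℕ+ => (lamN n i - ((n : ℕ) : ℝ) * lam i) / √((n : ℕ) : ℝ)) atTop (𝓝 (lamHat i)))
    (hmuHat : ∀ i, Tendsto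
      (fun n : ℕ+ => (muN n i - ((n : ℕ) : ℝ) * mu i) / √((n : ℕ) : ℝ)) atTop (𝓝 (muHat i)))
    (hnuHat : ∀ i, Tendsto
      (fun n : ℕ+ => (nuN n i - ((n : ℕ) : ℝ) * nu i) / √((n : ℕ) : ℝ)) atTop (𝓝 (nuHat i)))
    -- heavy traffic, and the standing condition on the reflection directions
    (hheavy : ∀ i, lam i = mu i)
    (hdir : mu 0 * mu 1 < nu 0 * nu 1)
    (hxHat : Tendsto (fun n => rescale n (xN n)) atTop (𝓝 xHat))
    (X : ℕ+ → Ω → SkorokhodSpace (Fin 2 → ℕ))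
    (hX : ∀ n, IsMarkovJumpProcess μ (quadrantIntensity (lamN n) (muN n) (nuN n)) (xN n) (X n)) :
    IsCTightProcesses μ fun n ω => (X n ω).map (rescale n) (continuous_rescale n) := by
  obtain ⟨R, hR⟩ := (isBounded_range_pnat hxHat).subset_closedBall xHat
  refine isCTightProcesses_of_hasOsc μ _
    (fun n => measurable_map_of_discrete _ (hX n).measurable)
    (fun n => isTightMeasureSet_map_of_discrete _ _ (hX n).measurable) xHat R
    (fun n => (hX n).initial.mono fun ω hω => ?_) fun T ε η hε hη => ?_
  · change rescale n (X n ω 0) ∈ _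
    rw [hω]
    exact hR (mem_range_self n)
  have l1 := fun i => tendsto_div_of_tendsto_sub_div_sqrt (hlamHat i)
  have m1 := fun i => tendsto_div_of_tendsto_sub_div_sqrt (hmuHat i)
  have n1 := fun i => tendsto_div_of_tendsto_sub_div_sqrt (hnuHat i)
  obtain ⟨ρ, hρ0, hρ₁, hρ₂⟩ : ∃ ρ : ℝ, 0 ≤ ρ ∧ (∀ i : Fin 2, nu i < ρ * mu i.rev) ∧
      ∀ i : Fin 2, mu i < ρ * nu i.rev := by
    have h : ∀ᶠ ρ : ℝ in atTop, 0 ≤ ρ ∧ (∀ i : Fin 2, nu i < ρ * mu i.rev) ∧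
        ∀ i : Fin 2, mu i < ρ * nu i.rev := by
      refine (eventually_ge_atTop 0).and ((eventually_all.2 fun i => ?_).and
        (eventually_all.2 fun i => ?_))
      · exact (tendsto_id.atTop_mul_const (hmu i.rev)).eventually_gt_atTop _
      · exact (tendsto_id.atTop_mul_const (hnu i.rev)).eventually_gt_atTop _
    exact h.exists
  -- The added `1` makes the bounds on the limits strict, so that they hold for the prelimit rates
  -- eventually.
  set C₀ := ∑ i, (lam i + mu i + nu i) + 1 with hC₀
  set C₁ := ∑ i, |lamHat i - muHat i| + 1 with hC₁
  have e1 : ∀ᶠ n in atTop, ∀ i, nuN n i ≤ ρ * muN n i.rev := eventually_all.2 fun i =>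
    eventually_le_of_tendsto_div (n1 i)
      (((m1 i.rev).const_mul ρ).congr fun n => by ring) (hρ₁ i)
  have e2 : ∀ᶠ n in atTop, ∀ i, muN n i ≤ ρ * nuN n i.rev := eventually_all.2 fun i =>
    eventually_le_of_tendsto_div (m1 i)
      (((n1 i.rev).const_mul ρ).congr fun n => by ring) (hρ₂ i)
  -- Strictness of the limiting direction condition carries it over to large `n`.
  have e3 : ∀ᶠ n in atTop, muN n 0 * muN n 1 ≤ nuN n 0 * nuN n 1 := by
    filter_upwards [((m1 0).mul (m1 1)).eventually_lt ((n1 0).mul (n1 1)) hdir] with n hn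
    have hn0 : (0 : ℝ) < ((n : ℕ) : ℝ) := by exact_mod_cast n.pos
    rw [div_mul_div_comm, div_mul_div_comm, div_lt_div_iff_of_pos_right (by positivity)] at hn
    exact hn.le
  have e4 : ∀ᶠ n : ℕ+ in atTop, ∑ i, (lamN n i + muN n i + nuN n i) ≤ C₀ * ((n : ℕ) : ℝ) := by
    have h1 : Tendsto (fun n : ℕ+ => (∑ i, (lamN n i + muN n i + nuN n i)) / ((n : ℕ) : ℝ)) atTop
        (𝓝 (∑ i, (lam i + mu i + nu i))) := by
      refine (tendsto_finsetSum Finset.univ fun i _ => ((l1 i).add (m1 i)).add (n1 i)).congr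
        fun n => ?_
      rw [Finset.sum_div]
      exact Finset.sum_congr rfl fun i _ => by ring
    filter_upwards [h1.eventually_le_const (lt_add_one _)] with n hn
    have hn0 : (0 : ℝ) < ((n : ℕ) : ℝ) := by exact_mod_cast n.pos
    rwa [div_le_iff₀ hn0] at hn
  have e5 : ∀ᶠ n : ℕ+ in atTop, ∀ i, |lamN n i - muN n i| ≤ C₁ * √((n : ℕ) : ℝ) := by
    refine eventually_all.2 fun i => ?_
    have h1 := ((hlamHat i).sub (hmuHat i)).abs
    have hlt : |lamHat i - muHat i| < C₁ := by
      have : |lamHat i - muHat i| ≤ ∑ i, |lamHat i - muHat i| :=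
        Finset.single_le_sum (f := fun i => |lamHat i - muHat i|)
        (fun i _ => abs_nonneg _) (Finset.mem_univ i)
      linarith
    filter_upwards [h1.eventually_le_const hlt] with n hn
    -- Heavy traffic cancels the terms of order `n`, leaving a drift of order `√n`.
    rw [← sub_div, hheavy i, sub_sub_sub_cancel_right, abs_div, abs_of_pos (sqrt_pnat_pos n),
      div_le_iff₀ (sqrt_pnat_pos n)] at hn
    exact hn
  -- Possible because `d log d → 0`. The choice of `d` precedes that of `n`, and `n` is then taken
  -- so large that the exponent `1 / (√n d)` is at most `1`.
  obtain ⟨d, hd0, hd1, hdε, hdη⟩ : ∃ d : ℝ, 0 < d ∧ d < 1 ∧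
      6 * ((1 + ρ) * (4 + 2 * ρ)) * (-4 * (d * Real.log d) + C₀ * d + C₁ * d ^ 2) ≤ ε ∧
      ENNReal.ofReal (4 * T * d ^ 2 + 8 * d ^ 4) ≤ η := by
    have h0 : ∀ᶠ d : ℝ in 𝓝[>] 0, d ∈ Ioo (0 : ℝ) 1 := Ioo_mem_nhdsGT one_pos
    have h1 : Tendsto (fun d : ℝ => 6 * ((1 + ρ) * (4 + 2 * ρ)) *
        (-4 * (d * Real.log d) + C₀ * d + C₁ * d ^ 2)) (𝓝[>] 0) (𝓝 0) := by
      have hcont : Continuous fun d : ℝ => 6 * ((1 + ρ) * (4 + 2 * ρ)) *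
          (-4 * (d * Real.log d) + C₀ * d + C₁ * d ^ 2) := by
        have := Real.continuous_mul_log
        fun_prop
      have := (hcont.tendsto 0).mono_left (nhdsWithin_le_nhds (s := Ioi 0))
      simpa using this
    have h2 : Tendsto (fun d : ℝ => ENNReal.ofReal (4 * T * d ^ 2 + 8 * d ^ 4)) (𝓝[>] 0)
        (𝓝 0) := by
      have hcont : Continuous fun d : ℝ => ENNReal.ofReal (4 * T * d ^ 2 + 8 * d ^ 4) :=
        ENNReal.continuous_ofReal.comp (by fun_prop)
      have := (hcont.tendsto 0).mono_left (nhdsWithin_le_nhds (s := Ioi 0))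
      simpa using this
    obtain ⟨d, ha, hb, hc⟩ := (h0.and ((h1.eventually_le_const hε).and
      (h2.eventually_le_const hη))).exists
    exact ⟨d, ha.1, ha.2, hb, hc⟩
  have e6 : ∀ᶠ n : ℕ+ in atTop, 1 ≤ √((n : ℕ) : ℝ) * d :=
    (tendsto_sqrt_pnat.atTop_mul_const hd0).eventually_ge_atTop 1
  obtain ⟨n₀, hn₀⟩ := eventually_atTop.1 (e1.and (e2.and (e3.and (e4.and (e5.and e6)))))
  refine ⟨d ^ 2, by positivity, n₀, fun n hn => ?_⟩
  obtain ⟨f1, f2, f3, f4, f5, f6⟩ := hn₀ n hn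
  exact ((hX n).measure_hasOsc_le (hlamN n) (hmuN n) (hnuN n) f3 n f1 f2 f4 f5 hd0 hd1 f6 T
    hdε).trans hdη
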